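/- Let $M$ be a finite-dimensional (Hausdorff) paracompact smooth manifold without boundary, let $\mathfrak z$ be a Hausdorff locally convex real vector space (for instance a Mackey complete one), and let $p \ge 0$. Let $\Omega^k(M,\mathfrak z)$ be the space of smooth $\mathfrak z$-valued $k$-forms on $M$, with exterior derivative $d$ and, for a smooth vector field $X$, interior product $i_X$ (insertion of $X$ in the first slot) and Lie derivative $\mathcal L_X = i_X d + d\, i_X$. Let $\mathfrak h := \mathcal V(M)$ be the Lie algebra of smooth vector fields on $M$ and $$V := \Omega^p(M,\mathfrak z)/d\Omega^{p-1}(M,\mathfrak z) \qquad (d\Omega^{-1} := 0),$$ considered as an $\mathfrak h$-module by $X.[\alpha] := [\mathcal L_X\alpha]$. For a Lie algebra $\mathfrak h$, an $\mathfrak h$-module $V$ and an alternating bilinear $2$-cochain $\omega : \mathfrak h \times \mathfrak h \to V$, let $d_{\mathfrak h}$ be the Chevalley--Eilenberg differential, $(i_\xi\omega)(x) := \omega(\xi,x)$, $(\mathcal L_\xi\omega)(x,y) := \xi.\omega(x,y) - \omega([\xi,x],y) - \omega(x,[\xi,y])$, and $$\mathfrak{sp}(\mathfrak h,\omega) :=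 \{\xi \in \mathfrak h : \mathcal L_\xi\omega = 0,\ i_\xi d_{\mathfrak h}\omega = 0\},\qquad \mathfrak{ham}(\mathfrak h,\omega) := \{\xi \in \mathfrak{sp}(\mathfrak h,\omega) : (\exists v \in V)\ i_\xi\omega = d_{\mathfrak h}v\}.$$ For $\tilde\omega \in \Omega^{p+2}(M,\mathfrak z)$ let $$\mathfrak{sp}(M,\tilde\omega) := \{X \in \mathcal V(M) : \mathcal L_X\tilde\omega = 0,\ i_X d\tilde\omega = 0\},\qquad \mathfrak{ham}(M,\tilde\omega) := \{X \in \mathfrak{sp}(M,\tilde\omega) : i_X\tilde\omega \in d\Omega^p(M,\mathfrak z)\}.$$ Let $\tilde\omega \in \Omega^{p+2}(M,\mathfrak z)$ and let $\omega$ be the $V$-valued $2$-cochain on $\mathfrak h = \mathcal V(M)$ given by $\omega(X,Y) := [i_Y i_X\tilde\omega]$. Then: (a) $\omega$ is a $2$-cocycle, i.e. $d_{\mathfrak h}\omega = 0$, if and only if $\tilde\omega$ is closed, i.e. $d\tilde\omega = 0$. (b) $\mathfrak{sp}(\mathfrak h,\omega) = \mathfrak{sp}(M,\tilde\omega)$.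 (c) $\mathfrak{ham}(\mathfrak h,\omega) = \mathfrak{ham}(M,\tilde\omega)$. -/

import Mathlib

open Set Filter Topology
open scoped Manifold ContDiff

section AbstractHamiltonian

open LieModule.Cohomology

variable {L V : Type*} [LieRing L] [LieAlgebra ℝ L] [AddCommGroup V] [Module ℝ V]
  [LieRingModule L V] [LieModule ℝ L V]

/-- The symplectic elements `{ξ | L_ξ c = 0, i_ξ dc = 0}` of a Lie algebra with a `2`-cochain `c`,
where `(L_ξ c)(x, y) = ξ.c(x, y) - c([ξ, x], y) - c(x, [ξ, y])`. -/
def symplecticElements (c : twoCochain ℝ L V) : Set L :=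
  {ξ | (∀ x y : L, ⁅ξ, c x y⁆ - c ⁅ξ, x⁆ y - c x ⁅ξ, y⁆ = 0) ∧ d₂₃ ℝ L V c ξ = 0}

/-- The hamiltonian elements of a Lie algebra with a `2`-cochain `c`: those symplectic `ξ` for
which `i_ξ c` is the coboundary `x ↦ x.v` of some `v`. -/
def hamiltonianElements (c : twoCochain ℝ L V) : Set L :=
  {ξ | ξ ∈ symplecticElements c ∧ ∃ v : V, ∀ x : L, c ξ x = ⁅x, v⁆}

end AbstractHamiltonian

section DirectionalCalculus

variable {E F : Type*} [NormedAddCommGroup E] [NormedSpace ℝ E]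
  [AddCommGroup F] [Module ℝ F] [TopologicalSpace F]

/-- `f` has the directional derivative `f'` at `x` in direction `v`:
`(f (x + t v) - f x) / t → f'` as `t → 0`. The target is any topological vector space. -/
def HasDirDeriv (f : E → F) (f' : F) (x v : E) : Prop :=
  Tendsto (fun t : ℝ => t⁻¹ • (f (x + t • v) - f x)) (𝓝[≠] 0) (𝓝 f')

/-- The directional derivative of `f` at `x` in direction `v` (meaningful if it exists). -/
noncomputable def dirDeriv (f : E → F) (x v : E) : F :=
  @limUnder _ _ _ ⟨0⟩ (𝓝[≠] (0 : ℝ)) (fun t : ℝ => t⁻¹ • (f (x + t • v) - f x))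

/-- `f` is of class `C^n` on the set `U` (meant to be open): all iterated
directional derivatives of order at most `n` exist on `U` and are continuous there. -/
def IsCnOn (U : Set E) : ℕ → (E → F) → Prop
  | 0, f => ContinuousOn f U
  | n + 1, f => ContinuousOn f U ∧ ∀ v : E, (∀ x ∈ U, ∃ f', HasDirDeriv f f' x v) ∧
      IsCnOn U n (fun x => dirDeriv f x v)

/-- Smooth maps from an open subset of a finite-dimensional space to a topological vector space. -/
def IsSmoothOn (U : Set E) (f : E → F) : Prop := ∀ n, IsCnOn U n f

theorem HasDirDeriv.dirDeriv_eq [T2Space F] {f : E → F} {f' : F} {x v : E}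
    (h : HasDirDeriv f f' x v) : dirDeriv f x v = f' :=
  haveI : Nonempty F := ⟨0⟩
  Tendsto.limUnder_eq h

theorem HasDirDeriv.congr {f g : E → F} {f' : F} {x v : E} (h : HasDirDeriv f f' x v)
    (hfg : f =ᶠ[𝓝 x] g) : HasDirDeriv g f' x v := by
  refine Tendsto.congr' ?_ h
  have hc : Tendsto (fun t : ℝ => x + t • v) (𝓝[≠] 0) (𝓝 x) := by
    have : Continuous (fun t : ℝ => x + t • v) := by fun_prop
    have h0 := this.tendsto 0
    simp only [zero_smul, add_zero] at h0
    exact h0.mono_left nhdsWithin_le_nhds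
  filter_upwards [hc.eventually hfg] with t ht
  rw [ht, hfg.self_of_nhds]

theorem dirDeriv_congr {f g : E → F} {x v : E} (hfg : f =ᶠ[𝓝 x] g) :
    dirDeriv f x v = dirDeriv g x v := by
  have hc : Tendsto (fun t : ℝ => x + t • v) (𝓝[≠] 0) (𝓝 x) := by
    have : Continuous (fun t : ℝ => x + t • v) := by fun_prop
    have h0 := this.tendsto 0
    simp only [zero_smul, add_zero] at h0
    exact h0.mono_left nhdsWithin_le_nhds
  unfold dirDeriv limUnder
  congr 1
  refine Filter.map_congr ?_
  filter_upwards [hc.eventually hfg] with t ht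
  rw [ht, hfg.self_of_nhds]

theorem IsCnOn.continuousOn {U : Set E} {n : ℕ} {f : E → F} (h : IsCnOn U n f) :
    ContinuousOn f U := by
  cases n with
  | zero => exact h
  | succ n => exact h.1

theorem IsCnOn.congr {U : Set E} (hU : IsOpen U) {n : ℕ} {f g : E → F} (h : IsCnOn U n f)
    (hfg : EqOn f g U) : IsCnOn U n g := by
  induction n generalizing f g with
  | zero => exact ContinuousOn.congr h hfg.symm
  | succ n ih =>
    refine ⟨h.1.congr hfg.symm, fun v => ⟨fun x hx => ?_, ?_⟩⟩
    · obtain ⟨f', hf'⟩ := (h.2 v).1 x hx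
      exact ⟨f', hf'.congr (hfg.eventuallyEq_of_mem (hU.mem_nhds hx))⟩
    · refine ih (h.2 v).2 fun x hx => dirDeriv_congr (hfg.eventuallyEq_of_mem (hU.mem_nhds hx))

theorem IsSmoothOn.congr {U : Set E} (hU : IsOpen U) {f g : E → F} (h : IsSmoothOn U f)
    (hfg : EqOn f g U) : IsSmoothOn U g := fun n => (h n).congr hU hfg

theorem IsSmoothOn.exists_hasDirDeriv {U : Set E} {f : E → F}
    (h : IsSmoothOn U f) {x : E} (hx : x ∈ U) (v : E) :
    ∃ f', HasDirDeriv f f' x v := ((h 1).2 v).1 x hx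

theorem IsSmoothOn.hasDirDeriv [T2Space F] {U : Set E} {f : E → F}
    (h : IsSmoothOn U f) {x : E} (hx : x ∈ U) (v : E) :
    HasDirDeriv f (dirDeriv f x v) x v := by
  obtain ⟨f', hf'⟩ := h.exists_hasDirDeriv hx v
  rwa [hf'.dirDeriv_eq]

theorem IsSmoothOn.dirDeriv {U : Set E} {f : E → F} (h : IsSmoothOn U f) (v : E) :
    IsSmoothOn U (fun x => dirDeriv f x v) := fun n => ((h (n + 1)).2 v).2

theorem HasDirDeriv.add [ContinuousAdd F] {f g : E → F} {f' g' : F} {x v : E}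
    (hf : HasDirDeriv f f' x v) (hg : HasDirDeriv g g' x v) :
    HasDirDeriv (fun y => f y + g y) (f' + g') x v := by
  refine (Tendsto.add hf hg).congr fun t => ?_
  rw [← smul_add, add_sub_add_comm]

theorem HasDirDeriv.const_smul [ContinuousConstSMul ℝ F] {f : E → F} {f' : F} {x v : E}
    (c : ℝ) (hf : HasDirDeriv f f' x v) :
    HasDirDeriv (fun y => c • f y) (c • f') x v := by
  refine (Tendsto.const_smul hf c).congr fun t => ?_
  rw [smul_comm, smul_sub]

theorem HasDirDeriv.map {G : Type*} [AddCommGroup G] [Module ℝ G] [TopologicalSpace G]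
    (L : F →L[ℝ] G) {f : E → F} {f' : F} {x v : E} (hf : HasDirDeriv f f' x v) :
    HasDirDeriv (fun y => L (f y)) (L f') x v := by
  refine ((L.continuous.tendsto f').comp hf).congr fun t => ?_
  simp

theorem HasDirDeriv.smul [ContinuousAdd F] [ContinuousSMul ℝ F] {a : E → ℝ} {a' : ℝ} {f : E → F}
    {f' : F} {x v : E} (hac : ContinuousAt a x)
    (ha : HasDirDeriv a a' x v) (hf : HasDirDeriv f f' x v) :
    HasDirDeriv (fun y => a y • f y) (a x • f' + a' • f x) x v := by
  have hc : Tendsto (fun t : ℝ => x + t • v) (𝓝[≠] 0) (𝓝 x) := by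
    have : Continuous (fun t : ℝ => x + t • v) := by fun_prop
    have h0 := this.tendsto 0
    simp only [zero_smul, add_zero] at h0
    exact h0.mono_left nhdsWithin_le_nhds
  refine (((hac.tendsto.comp hc).smul hf).add (Tendsto.smul ha tendsto_const_nhds)).congr
    fun t => ?_
  simp only [Function.comp, smul_sub, sub_smul, smul_smul, smul_eq_mul, mul_sub]
  rw [mul_comm t⁻¹ (a (x + t • v))]
  abel

theorem IsCnOn.mono {U : Set E} {n m : ℕ} (hmn : m ≤ n) {f : E → F} (h : IsCnOn U n f) :
    IsCnOn U m f := by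
  induction m generalizing n f with
  | zero => exact h.continuousOn
  | succ m ih =>
    obtain ⟨n, rfl⟩ : ∃ k, n = k + 1 := ⟨n - 1, by omega⟩
    exact ⟨h.1, fun v => ⟨(h.2 v).1, ih (by omega) (h.2 v).2⟩⟩

variable [T2Space F]

theorem IsCnOn.add [ContinuousAdd F] {U : Set E} (hU : IsOpen U) {n : ℕ} {f g : E → F}
    (hf : IsCnOn U n f) (hg : IsCnOn U n g) : IsCnOn U n (fun x => f x + g x) := by
  induction n generalizing f g with
  | zero => exact ContinuousOn.add hf hg
  | succ n ih =>
    refine ⟨hf.1.add hg.1, fun v => ⟨fun x hx => ?_, ?_⟩⟩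
    · obtain ⟨f', hf'⟩ := (hf.2 v).1 x hx
      obtain ⟨g', hg'⟩ := (hg.2 v).1 x hx
      exact ⟨_, hf'.add hg'⟩
    · refine (ih (hf.2 v).2 (hg.2 v).2).congr hU fun x hx => ?_
      obtain ⟨f', hf'⟩ := (hf.2 v).1 x hx
      obtain ⟨g', hg'⟩ := (hg.2 v).1 x hx
      simp only [(hf'.add hg').dirDeriv_eq, hf'.dirDeriv_eq, hg'.dirDeriv_eq]

theorem IsCnOn.const_smul [ContinuousConstSMul ℝ F] {U : Set E} (hU : IsOpen U) {n : ℕ}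
    {f : E → F} (c : ℝ) (hf : IsCnOn U n f) : IsCnOn U n (fun x => c • f x) := by
  induction n generalizing f with
  | zero => exact ContinuousOn.const_smul hf c
  | succ n ih =>
    refine ⟨hf.1.const_smul c, fun v => ⟨fun x hx => ?_, ?_⟩⟩
    · obtain ⟨f', hf'⟩ := (hf.2 v).1 x hx
      exact ⟨_, hf'.const_smul c⟩
    · refine (ih (hf.2 v).2).congr hU fun x hx => ?_
      obtain ⟨f', hf'⟩ := (hf.2 v).1 x hx
      simp only [(hf'.const_smul c).dirDeriv_eq, hf'.dirDeriv_eq]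

theorem IsCnOn.map {G : Type*} [AddCommGroup G] [Module ℝ G] [TopologicalSpace G] [T2Space G]
    (L : F →L[ℝ] G) {U : Set E} (hU : IsOpen U) {n : ℕ} {f : E → F} (hf : IsCnOn U n f) :
    IsCnOn U n (fun x => L (f x)) := by
  induction n generalizing f with
  | zero => exact L.continuous.comp_continuousOn hf
  | succ n ih =>
    refine ⟨L.continuous.comp_continuousOn hf.1, fun v => ⟨fun x hx => ?_, ?_⟩⟩
    · obtain ⟨f', hf'⟩ := (hf.2 v).1 x hx
      exact ⟨_, hf'.map L⟩
    · refine (ih (hf.2 v).2).congr hU fun x hx => ?_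
      obtain ⟨f', hf'⟩ := (hf.2 v).1 x hx
      simp only [(hf'.map L).dirDeriv_eq, hf'.dirDeriv_eq]

theorem IsCnOn.smul [ContinuousAdd F] [ContinuousSMul ℝ F] {U : Set E} (hU : IsOpen U) {n : ℕ}
    {a : E → ℝ} {f : E → F} (ha : IsCnOn U n a) (hf : IsCnOn U n f) :
    IsCnOn U n (fun x => a x • f x) := by
  induction n generalizing a f with
  | zero => exact ContinuousOn.smul ha hf
  | succ n ih =>
    refine ⟨ha.1.smul hf.1, fun v => ⟨fun x hx => ?_, ?_⟩⟩
    · obtain ⟨f', hf'⟩ := (hf.2 v).1 x hx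
      obtain ⟨a', ha'⟩ := (ha.2 v).1 x hx
      exact ⟨_, ha'.smul (ha.1.continuousAt (hU.mem_nhds hx)) hf'⟩
    · refine ((ih (ha.mono n.le_succ) (hf.2 v).2).add hU
        (ih (ha.2 v).2 (hf.mono n.le_succ))).congr hU fun x hx => ?_
      obtain ⟨f', hf'⟩ := (hf.2 v).1 x hx
      obtain ⟨a', ha'⟩ := (ha.2 v).1 x hx
      simp only [(ha'.smul (ha.1.continuousAt (hU.mem_nhds hx)) hf').dirDeriv_eq,
        hf'.dirDeriv_eq, ha'.dirDeriv_eq]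

theorem IsSmoothOn.sum {ι : Type*} [ContinuousAdd F] {U : Set E} (hU : IsOpen U)
    {f : ι → E → F} (s : Finset ι) (hf : ∀ i ∈ s, IsSmoothOn U (f i)) :
    IsSmoothOn U (fun x => ∑ i ∈ s, f i x) := by
  classical
  induction s using Finset.induction_on with
  | empty =>
    intro n
    simp only [Finset.sum_empty]
    induction n with
    | zero => exact continuousOn_const
    | succ n ih =>
      have h0 : ∀ x v : E, HasDirDeriv (fun _ : E => (0 : F)) 0 x v := fun x v => by
        simp [HasDirDeriv]
      refine ⟨continuousOn_const, fun v => ⟨fun x _ => ⟨0, h0 x v⟩, ?_⟩⟩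
      simpa only [(h0 _ v).dirDeriv_eq] using ih
  | insert a s ha ih =>
    intro n
    simp only [Finset.sum_insert ha]
    exact (hf a (by simp) n).add hU (ih (fun i hi => hf i (by simp [hi])) n)

end DirectionalCalculus

section Real

variable {E : Type*} [NormedAddCommGroup E] [NormedSpace ℝ E]

theorem hasDirDeriv_iff_hasDerivAt {f : E → ℝ} {f' : ℝ} {x v : E} :
    HasDirDeriv f f' x v ↔ HasDerivAt (fun t : ℝ => f (x + t • v)) f' 0 := by
  rw [hasDerivAt_iff_tendsto_slope_zero]
  simp [HasDirDeriv]

theorem HasFDerivAt.hasDirDeriv {f : E → ℝ} {f' : E →L[ℝ] ℝ} {x : E} (h : HasFDerivAt f f' x)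
    (v : E) : HasDirDeriv f (f' v) x v := by
  rw [hasDirDeriv_iff_hasDerivAt]
  have := h.hasLineDerivAt v
  exact this

theorem isCnOn_of_contDiffOn {U : Set E} (hU : IsOpen U) {f : E → ℝ} {n : ℕ}
    (h : ContDiffOn ℝ n f U) : IsCnOn U n f := by
  induction n generalizing f with
  | zero => exact h.continuousOn
  | succ n ih =>
    have hd : ∀ x ∈ U, HasFDerivAt f (fderiv ℝ f x) x := fun x hx =>
      ((h.differentiableOn (by simp)).differentiableAt (hU.mem_nhds hx)).hasFDerivAt
    refine ⟨h.continuousOn, fun v => ⟨fun x hx => ⟨_, (hd x hx).hasDirDeriv v⟩, ?_⟩⟩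
    have h1 : ContDiffOn ℝ n (fun x => fderiv ℝ f x v) U :=
      (h.fderiv_of_isOpen (m := n) hU (by simp)).clm_apply contDiffOn_const
    exact (ih h1).congr hU fun x hx => ((hd x hx).hasDirDeriv v).dirDeriv_eq.symm

theorem isSmoothOn_of_contDiffOn {U : Set E} (hU : IsOpen U) {f : E → ℝ}
    (h : ContDiffOn ℝ ∞ f U) : IsSmoothOn U f := fun n =>
  isCnOn_of_contDiffOn hU (h.of_le (by exact_mod_cast le_top))

/-- Continuous directional derivatives imply Fréchet differentiability in finite dimension. -/
theorem IsCnOn.hasFDerivAt [FiniteDimensional ℝ E] {U : Set E} (hU : IsOpen U) {f : E → ℝ}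
    (h : IsCnOn U 1 f) {x : E} (hx : x ∈ U) : ∃ f' : E →L[ℝ] ℝ, HasFDerivAt f f' x := by
  classical
  let b := Module.finBasis ℝ E
  let g : Fin (Module.finrank ℝ E) → E → ℝ := fun i y => dirDeriv f y (b i)
  have hgc : ∀ i, ContinuousAt (g i) x := fun i =>
    ContinuousOn.continuousAt (h.2 (b i)).2 (hU.mem_nhds hx)
  have hg : ∀ i, ∀ y ∈ U, HasDirDeriv f (g i y) y (b i) := fun i y hy => by
    obtain ⟨f', hf'⟩ := (h.2 (b i)).1 y hy
    simpa only [g, hf'.dirDeriv_eq] using hf'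
  -- the estimate along partial sums
  have key : ∀ ε > 0, ∀ s : Finset (Fin (Module.finrank ℝ E)), ∃ δ > 0,
      ∀ y ∈ Metric.ball x δ, ∀ c : Fin (Module.finrank ℝ E) → ℝ, (∀ i, |c i| < δ) →
        |f (y + ∑ i ∈ s, c i • b i) - f y - ∑ i ∈ s, c i * g i x| ≤ ε * ∑ i ∈ s, |c i| := by
    intro ε hε s
    induction s using Finset.induction_on with
    | empty => exact ⟨1, one_pos, fun y _ c _ => by simp⟩
    | insert j s hj ih =>
      obtain ⟨δ, hδ, H⟩ := ih
      obtain ⟨η, hη, Hη⟩ := Metric.mem_nhds_iff.1 (Filter.inter_mem (hU.mem_nhds hx)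
        ((hgc j).preimage_mem_nhds (Metric.ball_mem_nhds (g j x) hε)))
      have hbj : 0 < 1 + ‖b j‖ := by positivity
      set ρ := min δ η / (1 + ‖b j‖) / 2 with hρ
      have hmin : 0 < min δ η := lt_min hδ hη
      have hρ0 : 0 < ρ := by positivity
      have hρ2 : ρ * (1 + ‖b j‖) * 2 = min δ η := by rw [hρ]; field_simp
      have hstep : ∀ y ∈ Metric.ball x ρ, ∀ t : ℝ, |t| ≤ ρ → y + t • b j ∈
          Metric.ball x (min δ η) := by
        intro y hy t ht
        rw [Metric.mem_ball, dist_eq_norm] at hy ⊢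
        have h1 : ‖y + t • b j - x‖ ≤ ‖y - x‖ + |t| * ‖b j‖ := by
          calc ‖y + t • b j - x‖ = ‖(y - x) + t • b j‖ := by congr 1; abel
            _ ≤ _ := (norm_add_le _ _).trans (by rw [norm_smul, Real.norm_eq_abs])
        nlinarith [norm_nonneg (b j), mul_le_mul_of_nonneg_right ht (norm_nonneg (b j)),
          mul_nonneg hρ0.le (norm_nonneg (b j))]
      have hρδ : ρ ≤ δ := by
        have := min_le_left δ η
        nlinarith [norm_nonneg (b j), mul_nonneg hρ0.le (norm_nonneg (b j))]
      refine ⟨ρ, hρ0, fun y hy c hc => ?_⟩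
      have hcj := hc j
      have h1 := H (y + c j • b j)
        (Metric.ball_subset_ball (min_le_left _ _) (hstep y hy (c j) hcj.le)) c
        (fun i => (hc i).trans_le hρδ)
      have h2 : |f (y + c j • b j) - f y - c j * g j x| ≤ ε * |c j| := by
        let φ : ℝ → ℝ := fun t => f (y + t • b j) - t * g j x
        have hmem : ∀ t ∈ Icc (-ρ) ρ, y + t • b j ∈ Metric.ball x η := fun t ht =>
          Metric.ball_subset_ball (min_le_right _ _) (hstep y hy t (abs_le.2 ht))
        have hφ : ∀ t ∈ Icc (-ρ) ρ, HasDerivWithinAt φ (g j (y + t • b j) - g j x)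
            (Icc (-ρ) ρ) t := by
          intro t ht
          have h3 := hasDirDeriv_iff_hasDerivAt.1 (hg j _ (Hη (hmem t ht)).1)
          have h4 : HasDerivAt (fun s : ℝ => f (y + s • b j)) (g j (y + t • b j)) t := by
            have h5 : HasDerivAt (fun s : ℝ => s - t) 1 t := (hasDerivAt_id t).sub_const t
            have h3' : HasDerivAt (fun s : ℝ => f (y + t • b j + s • b j))
              (g j (y + t • b j)) (t - t) := by simpa using h3
            have := HasDerivAt.comp (h := fun s : ℝ => s - t) t h3' h5
            simp only [mul_one] at this
            refine this.congr_of_eventuallyEq (Eventually.of_forall fun s => ?_)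
            simp only [Function.comp, add_assoc, ← add_smul]
            congr 3; ring
          have h6 := (hasDerivAt_id t).mul_const (g j x)
          simp only [one_mul] at h6
          exact (h4.sub h6).hasDerivWithinAt
        have h7 := Convex.norm_image_sub_le_of_norm_hasDerivWithin_le (C := ε) hφ
          (fun t ht => by
            have := (Hη (hmem t ht)).2
            rw [mem_preimage, Metric.mem_ball, dist_eq_norm] at this
            exact this.le) (convex_Icc _ _)
          (x := 0) (y := c j) ⟨by linarith, hρ0.le⟩ (abs_le.1 hcj.le)
        simp only [φ, zero_smul, add_zero, zero_mul, sub_zero, Real.norm_eq_abs] at h7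
        convert h7 using 2
        ring
      rw [Finset.sum_insert hj, Finset.sum_insert hj, Finset.sum_insert hj, ← add_assoc, mul_add]
      calc _ = |(f (y + c j • b j) - f y - c j * g j x) +
            (f (y + c j • b j + ∑ i ∈ s, c i • b i) - f (y + c j • b j)
              - ∑ i ∈ s, c i * g i x)| := by congr 1; ring
        _ ≤ _ := (abs_add_le _ _).trans (add_le_add h2 h1)
  let f' : E →ₗ[ℝ] ℝ := ∑ i, (g i x) • b.coord i
  refine ⟨LinearMap.toContinuousLinearMap f', ?_⟩
  let C : Fin (Module.finrank ℝ E) → ℝ := fun i => ‖LinearMap.toContinuousLinearMap (b.coord i)‖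
  have hC : ∀ i v, |b.repr v i| ≤ C i * ‖v‖ := fun i v =>
    (LinearMap.toContinuousLinearMap (b.coord i)).le_opNorm v
  have hC0 : ∀ i, 0 ≤ C i := fun i => norm_nonneg _
  have hS : 0 ≤ ∑ i, C i := Finset.sum_nonneg fun i _ => hC0 i
  rw [hasFDerivAt_iff_isLittleO_nhds_zero, Asymptotics.isLittleO_iff]
  intro ε hε
  obtain ⟨δ, hδ, H⟩ := key (ε / (1 + ∑ i, C i)) (by positivity) Finset.univ
  have hr : 0 < δ / (1 + ∑ i, C i) := by positivity
  filter_upwards [Metric.ball_mem_nhds (0 : E) hr] with v hv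
  rw [mem_ball_zero_iff, lt_div_iff₀ (by positivity)] at hv
  have h1 := H x (Metric.mem_ball_self hδ) (fun i => b.repr v i) (fun i => by
    have h2 : C i ≤ ∑ i, C i := Finset.single_le_sum (fun i _ => hC0 i) (Finset.mem_univ i)
    nlinarith [hC i v, norm_nonneg v, mul_le_mul_of_nonneg_right h2 (norm_nonneg v)])
  rw [b.sum_repr] at h1
  have h3 : LinearMap.toContinuousLinearMap f' v = ∑ i, b.repr v i * g i x := by
    simp [f', mul_comm]
  rw [h3, Real.norm_eq_abs]
  refine h1.trans ?_
  rw [div_mul_eq_mul_div, div_le_iff₀ (by positivity), mul_assoc]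
  refine mul_le_mul_of_nonneg_left ?_ hε.le
  calc ∑ i, |b.repr v i| ≤ ∑ i, C i * ‖v‖ := Finset.sum_le_sum fun i _ => hC i v
    _ = (∑ i, C i) * ‖v‖ := by rw [Finset.sum_mul]
    _ ≤ _ := by nlinarith [norm_nonneg v]

theorem contDiffOn_of_isCnOn [FiniteDimensional ℝ E] {U : Set E} (hU : IsOpen U) {n : ℕ}
    {f : E → ℝ} (h : IsCnOn U n f) : ContDiffOn ℝ n f U := by
  induction n generalizing f with
  | zero => exact contDiffOn_zero.2 h
  | succ n ih =>
    have hd : ∀ x ∈ U, HasFDerivAt f (fderiv ℝ f x) x := fun x hx => by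
      obtain ⟨f', hf'⟩ := IsCnOn.hasFDerivAt hU (h.mono (by omega)) hx
      exact hf'.differentiableAt.hasFDerivAt
    push_cast
    rw [contDiffOn_succ_iff_fderiv_of_isOpen hU]
    refine ⟨fun x hx => (hd x hx).differentiableAt.differentiableWithinAt, by simp, ?_⟩
    rw [contDiffOn_clm_apply]
    intro v
    exact (ih (h.2 v).2).congr fun x hx => ((hd x hx).hasDirDeriv v).dirDeriv_eq.symm

theorem contDiffOn_of_isSmoothOn [FiniteDimensional ℝ E] {U : Set E} (hU : IsOpen U)
    {f : E → ℝ} (h : IsSmoothOn U f) : ContDiffOn ℝ ∞ f U :=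
  contDiffOn_infty.2 fun n => contDiffOn_of_isCnOn hU (h n)

end Real

section EuclideanForms

variable {E F : Type*} [NormedAddCommGroup E] [NormedSpace ℝ E] [FiniteDimensional ℝ E]
  [AddCommGroup F] [Module ℝ F] [TopologicalSpace F]

/-- A real alternating form on a finite-dimensional space, as a continuous one. -/
noncomputable def AlternatingMap.toCont {k : ℕ} (f : E [⋀^Fin k]→ₗ[ℝ] ℝ) :
    E [⋀^Fin k]→L[ℝ] ℝ :=
  { f with
    cont := by
      let b := Module.finBasis ℝ E
      have h : ∀ v : Fin k → E, f v = ∑ r : Fin k → Fin (Module.finrank ℝ E),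
          (∏ i, b.repr (v i) (r i)) • f (fun i => b (r i)) := by
        intro v
        have h1 : f v = f (fun i => ∑ j, b.repr (v i) j • b j) := by
          congr 1; funext i; exact (b.sum_repr (v i)).symm
        rw [h1]
        refine (f.toMultilinearMap.map_sum fun i j => b.repr (v i) j • b j).trans ?_
        refine Finset.sum_congr rfl fun r _ => ?_
        exact f.toMultilinearMap.map_smul_univ (fun i => b.repr (v i) (r i)) _
      change Continuous fun v => f v
      have h' : (fun v : Fin k → E => f v) = fun v => ∑ r : Fin k → Fin (Module.finrank ℝ E),
          (∏ i, b.repr (v i) (r i)) • f (fun i => b (r i)) := funext h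
      rw [h']
      refine continuous_finsetSum _ fun r _ => ?_
      have hc : ∀ i : Fin k, Continuous fun v : Fin k → E => b.repr (v i) (r i) := fun i =>
        (LinearMap.continuous_of_finiteDimensional (b.coord (r i))).comp (continuous_apply i)
      exact (continuous_finsetProd _ fun i _ => hc i).smul continuous_const }

@[simp] theorem AlternatingMap.toCont_apply {k : ℕ} (f : E [⋀^Fin k]→ₗ[ℝ] ℝ) (v : Fin k → E) :
    f.toCont v = f v := rfl

/-- The scalar form obtained from an `F`-valued form and a functional on `F`. -/
noncomputable def scalarForm {k : ℕ} (l : F →L[ℝ] ℝ) (β : E → E [⋀^Fin k]→ₗ[ℝ] F) :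
    E → E [⋀^Fin k]→L[ℝ] ℝ :=
  fun y => ((l : F →ₗ[ℝ] ℝ).compAlternatingMap (β y)).toCont

@[simp] theorem scalarForm_apply {k : ℕ} (l : F →L[ℝ] ℝ) (β : E → E [⋀^Fin k]→ₗ[ℝ] F) (y : E)
    (v : Fin k → E) : scalarForm l β y v = l (β y v) := rfl

theorem contDiffOn_altForm {k : ℕ} {n : WithTop ℕ∞} {U : Set E} {β : E → E [⋀^Fin k]→L[ℝ] ℝ}
    (h : ∀ w, ContDiffOn ℝ n (fun y => β y w) U) : ContDiffOn ℝ n β U := by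
  let b := Module.finBasis ℝ E
  let T : (E [⋀^Fin k]→L[ℝ] ℝ) →ₗ[ℝ] ((Fin k → Fin (Module.finrank ℝ E)) → ℝ) :=
    { toFun := fun f r => f (fun i => b (r i))
      map_add' := fun f g => rfl
      map_smul' := fun c f => rfl }
  have hT : Function.Injective T := by
    intro f g hfg
    apply ContinuousAlternatingMap.toAlternatingMap_injective
    refine Module.Basis.ext_alternating b fun r _ => ?_
    exact congrFun hfg r
  obtain ⟨S, hS⟩ := T.exists_leftInverse_of_injective (LinearMap.ker_eq_bot.2 hT)
  have h1 : ContDiffOn ℝ n (fun y => LinearMap.toContinuousLinearMap S (T (β y))) U := by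
    refine (LinearMap.toContinuousLinearMap S).contDiff.comp_contDiffOn ?_
    exact contDiffOn_pi.2 fun r => h _
  refine h1.congr fun y _ => ?_
  exact (LinearMap.congr_fun hS (β y)).symm

/-- The components of the form `β` are smooth on `U`. -/
def IsSmoothFormOn {k : ℕ} (U : Set E) (β : E → E [⋀^Fin k]→ₗ[ℝ] F) : Prop :=
  ∀ w : Fin k → E, IsSmoothOn U (fun y => β y w)

variable [T2Space F]

theorem IsSmoothFormOn.scalarForm {k : ℕ} {U : Set E} (hU : IsOpen U)
    {β : E → E [⋀^Fin k]→ₗ[ℝ] F} (h : IsSmoothFormOn U β) (l : F →L[ℝ] ℝ) :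
    ContDiffOn ℝ ∞ (scalarForm l β) U :=
  contDiffOn_altForm fun w => contDiffOn_of_isSmoothOn hU fun n => (h w n).map l hU

theorem eq_of_forall_functional [IsTopologicalAddGroup F] [ContinuousSMul ℝ F]
    [LocallyConvexSpace ℝ F] {a b : F} (h : ∀ l : F →L[ℝ] ℝ, l a = l b) : a = b :=
  (SeparatingDual.eq_iff_forall_dual_eq (R := ℝ)).2 h

/-- The usual formula `∑ (-1)^i (∂_{v_i} β)(v_0, …, v̂_i, …, v_k)` for the exterior derivative. -/
noncomputable def extDerivFormula {k : ℕ} (β : E → E [⋀^Fin k]→ₗ[ℝ] F) (x : E)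
    (v : Fin (k + 1) → E) : F :=
  ∑ i : Fin (k + 1), (-1 : ℝ) ^ (i : ℕ) • dirDeriv (fun y => β y (i.removeNth v)) x (v i)

theorem map_extDerivFormula {k : ℕ} {U : Set E} (hU : IsOpen U) {β : E → E [⋀^Fin k]→ₗ[ℝ] F}
    (h : IsSmoothFormOn U β) (l : F →L[ℝ] ℝ) {x : E} (hx : x ∈ U) (v : Fin (k + 1) → E) :
    l (extDerivFormula β x v) = extDeriv (scalarForm l β) x v := by
  have hd : DifferentiableAt ℝ (scalarForm l β) x :=
    ((h.scalarForm hU l).differentiableOn (by simp)).differentiableAt (hU.mem_nhds hx)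
  rw [extDeriv_apply hd, extDerivFormula, map_sum]
  refine Finset.sum_congr rfl fun i _ => ?_
  have h1 : DifferentiableAt ℝ (fun y => scalarForm l β y (i.removeNth v)) x :=
    hd.continuousAlternatingMap_apply_const _
  rw [map_smul, ← (((h _).hasDirDeriv hx (v i)).map l).dirDeriv_eq,
    ← (h1.hasFDerivAt.hasDirDeriv (v i)).dirDeriv_eq]
  simp only [scalarForm_apply]
  rw [← Int.cast_smul_eq_zsmul ℝ]
  push_cast
  rfl

variable [IsTopologicalAddGroup F] [ContinuousSMul ℝ F] [LocallyConvexSpace ℝ F]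

/-- The exterior derivative at `x` of a form with smooth components near `x`. -/
noncomputable def altExtDeriv {k : ℕ} (β : E → E [⋀^Fin k]→ₗ[ℝ] F) (x : E)
    (h : ∃ U : Set E, IsOpen U ∧ x ∈ U ∧ IsSmoothFormOn U β) : E [⋀^Fin (k + 1)]→ₗ[ℝ] F where
  toFun := extDerivFormula β x
  map_update_add' v i a b := by
    obtain ⟨U, hU, hx, hs⟩ := h
    refine eq_of_forall_functional fun l => ?_
    rw [map_add]
    simp only [map_extDerivFormula hU hs l hx]
    exact ContinuousAlternatingMap.map_update_add _ _ _ _ _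
  map_update_smul' v i c a := by
    obtain ⟨U, hU, hx, hs⟩ := h
    refine eq_of_forall_functional fun l => ?_
    rw [map_smul]
    simp only [map_extDerivFormula hU hs l hx]
    exact ContinuousAlternatingMap.map_update_smul _ _ _ _ _
  map_eq_zero_of_eq' v i j hv hij := by
    obtain ⟨U, hU, hx, hs⟩ := h
    refine eq_of_forall_functional fun l => ?_
    rw [map_extDerivFormula hU hs l hx, map_zero]
    exact (extDeriv (scalarForm l β) x).toAlternatingMap.map_eq_zero_of_eq v hv hij

end EuclideanForms

section EuclideanLie

variable {E : Type*} [NormedAddCommGroup E] [NormedSpace ℝ E]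

/-- The contraction of a form with a vector field. -/
noncomputable def contractForm {k : ℕ} (X : E → E) (B : E → E [⋀^Fin (k + 1)]→L[ℝ] ℝ) :
    E → E [⋀^Fin k]→L[ℝ] ℝ := fun y => (B y).curryLeft (X y)

/-- The coordinate formula `(L_X B)(w) = (∂_X B)(w) + ∑ B(…, ∂_{w_i} X, …)`. -/
noncomputable def lieFormula {k : ℕ} (X : E → E) (B : E → E [⋀^Fin k]→L[ℝ] ℝ) (x : E)
    (w : Fin k → E) : ℝ :=
  fderiv ℝ B x (X x) w + ∑ i, B x (Function.update w i (fderiv ℝ X x (w i)))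

theorem hasFDerivAt_contractForm {k : ℕ} {X : E → E} {B : E → E [⋀^Fin (k + 1)]→L[ℝ] ℝ} {x : E}
    (hB : DifferentiableAt ℝ B x) (hX : DifferentiableAt ℝ X x) :
    DifferentiableAt ℝ (contractForm X B) x ∧ ∀ h w, fderiv ℝ (contractForm X B) x h w =
      fderiv ℝ B x h (Matrix.vecCons (X x) w) + B x (Matrix.vecCons (fderiv ℝ X x h) w) := by
  have hb : IsBoundedBilinearMap ℝ
      (fun p : (E [⋀^Fin (k + 1)]→L[ℝ] ℝ) × E => p.1.curryLeft p.2) :=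
    { add_left := fun f g v => by simp
      smul_left := fun c f v => by simp
      add_right := fun f v w => by simp
      smul_right := fun c f v => by simp
      bound := ⟨1, one_pos, fun f v => by
        have := f.curryLeft.le_opNorm v
        rwa [ContinuousAlternatingMap.norm_curryLeft, ← one_mul ‖f‖] at this⟩ }
  have h1 := hb.hasFDerivAt (B x, X x)
  have h2 := hB.hasFDerivAt.prodMk hX.hasFDerivAt
  have h3 := HasFDerivAt.comp (f := fun y => (B y, X y)) x h1 h2
  change HasFDerivAt (contractForm X B) _ x at h3
  refine ⟨h3.differentiableAt, fun h w => ?_⟩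
  rw [h3.fderiv]
  simp [add_comm]

theorem extDeriv_zero_form {X : E → E} {B : E → E [⋀^Fin 0]→L[ℝ] ℝ} {x : E}
    (hB : DifferentiableAt ℝ B x) (w : Fin 0 → E) :
    extDeriv B x (Matrix.vecCons (X x) w) = lieFormula X B x w := by
  rw [extDeriv_apply hB]
  simp only [lieFormula, Fin.sum_univ_succ, Finset.univ_eq_empty, Finset.sum_empty, add_zero]
  rw [fderiv_continuousAlternatingMap_apply_const_apply hB]
  simp

theorem cartan_formula {k : ℕ} {X : E → E} {B : E → E [⋀^Fin (k + 1)]→L[ℝ] ℝ} {x : E}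
    (hB : DifferentiableAt ℝ B x) (hX : DifferentiableAt ℝ X x) (w : Fin (k + 1) → E) :
    extDeriv B x (Matrix.vecCons (X x) w) + extDeriv (contractForm X B) x w
      = lieFormula X B x w := by
  obtain ⟨h1, h2⟩ := hasFDerivAt_contractForm hB hX
  rw [extDeriv_apply hB, extDeriv_apply h1, Fin.sum_univ_succ]
  simp only [fderiv_continuousAlternatingMap_apply_const_apply hB,
    fderiv_continuousAlternatingMap_apply_const_apply h1, h2, lieFormula]
  have h3 : ∀ i : Fin (k + 1), B x (Function.update w i (fderiv ℝ X x (w i))) =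
      (-1) ^ (i : ℕ) • B x (Matrix.vecCons (fderiv ℝ X x (w i)) (i.removeNth w)) := by
    intro i
    rw [← ContinuousAlternatingMap.map_insertNth, Fin.insertNth_removeNth]
  simp only [h3]
  have h4 : ∀ i : Fin (k + 1), (i.succ).removeNth (Matrix.vecCons (X x) w) =
      Matrix.vecCons (X x) (i.removeNth w) := by
    intro i
    funext j
    refine Fin.cases ?_ (fun j => ?_) j
    · simp [Fin.removeNth]
    · simp [Fin.removeNth]
  simp only [h4, smul_add, Finset.sum_add_distrib]
  have h5 : (0 : Fin (k + 2)).removeNth (Matrix.vecCons (X x) w) = w := by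
    funext j; simp [Fin.removeNth]
  simp only [h5, Fin.val_zero, pow_zero, one_smul, Matrix.cons_val_zero, Fin.val_succ, pow_succ,
    Matrix.cons_val_succ]
  simp only [mul_neg, mul_one, neg_smul, Finset.sum_neg_distrib]
  ring

theorem lieFormula_contract {k : ℕ} {X Y : E → E} {B : E → E [⋀^Fin (k + 1)]→L[ℝ] ℝ} {x : E}
    (hB : DifferentiableAt ℝ B x) (hY : DifferentiableAt ℝ Y x) (w : Fin k → E) :
    lieFormula X (contractForm Y B) x w - lieFormula X B x (Matrix.vecCons (Y x) w)
      = B x (Matrix.vecCons (VectorField.lieBracket ℝ X Y x) w) := by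
  obtain ⟨h1, h2⟩ := hasFDerivAt_contractForm hB hY
  have h3 : ∀ u, Function.update (Matrix.vecCons (Y x) w) 0 u = Matrix.vecCons u w := by
    intro u
    funext j
    refine Fin.cases ?_ (fun j => ?_) j <;> simp
  have h4 : ∀ (i : Fin k) u, Function.update (Matrix.vecCons (Y x) w) i.succ u =
      Matrix.vecCons (Y x) (Function.update w i u) := by
    intro i u
    funext j
    refine Fin.cases ?_ (fun j => ?_) j
    · simp [Function.update_of_ne (Fin.succ_ne_zero i).symm]
    · by_cases hij : j = i
      · subst hij; simp
      · simp [Function.update_of_ne hij, Function.update_of_ne (fun h => hij (Fin.succ_injective _ h))]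
  have h5 : B x (Matrix.vecCons (fderiv ℝ Y x (X x) - fderiv ℝ X x (Y x)) w) =
      B x (Matrix.vecCons (fderiv ℝ Y x (X x)) w) -
      B x (Matrix.vecCons (fderiv ℝ X x (Y x)) w) := by
    simp only [← ContinuousAlternatingMap.curryLeft_apply_apply, map_sub]
    rfl
  simp only [lieFormula, h2, Fin.sum_univ_succ, h3, h4, VectorField.lieBracket, h5,
    Matrix.cons_val_zero, Matrix.cons_val_succ, contractForm,
    ContinuousAlternatingMap.curryLeft_apply_apply]
  ring

end EuclideanLie

section ManifoldForms

set_option linter.unusedSectionVars false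

open VectorField

variable (E : Type*) {M : Type*} (F : Type*) [NormedAddCommGroup E] [NormedSpace ℝ E]
  [FiniteDimensional ℝ E]
  [TopologicalSpace M] [ChartedSpace E M] [IsManifold 𝓘(ℝ, E) ∞ M]
  [AddCommGroup F] [Module ℝ F] [TopologicalSpace F]

/-- The Lie algebra of smooth vector fields on `M`. -/
abbrev VecField (E M : Type*) [NormedAddCommGroup E] [NormedSpace ℝ E]
    [TopologicalSpace M] [ChartedSpace E M] [IsManifold 𝓘(ℝ, E) ∞ M] : Type _ :=
  ContMDiffSection 𝓘(ℝ, E) E ∞ (TangentSpace 𝓘(ℝ, E) : M → Type _)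

variable (M) in
/-- Families of `F`-valued alternating `k`-forms on the tangent spaces of `M`. -/
abbrev PreForm (k : ℕ) : Type _ := (x : M) → (TangentSpace 𝓘(ℝ, E) x) [⋀^Fin k]→ₗ[ℝ] F

variable {E F}

/-- The tangent map at `y` of the inverse of the chart around `x₀`. -/
noncomputable def chartInvDeriv (x₀ : M) (y : E) :
    E →L[ℝ] TangentSpace 𝓘(ℝ, E) ((extChartAt 𝓘(ℝ, E) x₀).symm y) :=
  mfderiv 𝓘(ℝ, E) 𝓘(ℝ, E) (extChartAt 𝓘(ℝ, E) x₀).symm y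

/-- The tangent map at `x` of the chart around `x₀`. -/
noncomputable def chartDeriv (x₀ x : M) : TangentSpace 𝓘(ℝ, E) x →L[ℝ] E :=
  mfderiv 𝓘(ℝ, E) 𝓘(ℝ, E) (extChartAt 𝓘(ℝ, E) x₀) x

/-- The coordinate expression of a form in the chart around `x₀`. -/
noncomputable def localForm {k : ℕ} (x₀ : M) (α : PreForm E M F k) : E → E [⋀^Fin k]→ₗ[ℝ] F :=
  fun y => (α ((extChartAt 𝓘(ℝ, E) x₀).symm y)).compLinearMap (chartInvDeriv x₀ y).toLinearMap

/-- The coordinate expression of a vector field in the chart around `x₀`. -/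
noncomputable def localField (x₀ : M) (X : VecField E M) : E → E :=
  mpullback 𝓘(ℝ, E) 𝓘(ℝ, E) (extChartAt 𝓘(ℝ, E) x₀).symm X

theorem chartDeriv_self (x : M) : chartDeriv x x = ContinuousLinearMap.id ℝ E :=
  mfderiv_extChartAt_self

theorem mfderivWithin_range_eq (x₀ : M) (y : E) :
    mfderivWithin 𝓘(ℝ, E) 𝓘(ℝ, E) (extChartAt 𝓘(ℝ, E) x₀).symm (range 𝓘(ℝ, E)) y
      = chartInvDeriv x₀ y := by
  rw [modelWithCornersSelf_coe, range_id, mfderivWithin_univ]; rfl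

theorem chartDeriv_comp {x₀ : M} {y : E} (hy : y ∈ (extChartAt 𝓘(ℝ, E) x₀).target) (v : E) :
    chartDeriv x₀ ((extChartAt 𝓘(ℝ, E) x₀).symm y) (chartInvDeriv x₀ y v) = v := by
  have := mfderiv_extChartAt_comp_mfderivWithin_extChartAt_symm hy
  rw [mfderivWithin_range_eq] at this
  exact DFunLike.congr_fun this v

theorem chartInvDeriv_isInvertible {x₀ : M} {y : E} (hy : y ∈ (extChartAt 𝓘(ℝ, E) x₀).target) :
    (chartInvDeriv x₀ y).IsInvertible := by
  have := isInvertible_mfderivWithin_extChartAt_symm hy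
  rwa [mfderivWithin_range_eq] at this

theorem chartInvDeriv_localField {x₀ : M} {y : E} (hy : y ∈ (extChartAt 𝓘(ℝ, E) x₀).target)
    (X : VecField E M) :
    chartInvDeriv x₀ y (localField x₀ X y) = X ((extChartAt 𝓘(ℝ, E) x₀).symm y) :=
  (chartInvDeriv_isInvertible hy).self_apply_inverse _

theorem localField_smooth (x₀ : M) (X : VecField E M) :
    ContDiffOn ℝ ∞ (localField x₀ X) (extChartAt 𝓘(ℝ, E) x₀).target := by
  intro y hy
  have h1 : ContMDiffAt 𝓘(ℝ, E) 𝓘(ℝ, E) ∞ (extChartAt 𝓘(ℝ, E) x₀).symm y :=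
    ((contMDiffOn_extChartAt_symm x₀).contMDiffAt
      ((isOpen_extChartAt_target x₀).mem_nhds hy))
  have hi : (mfderiv 𝓘(ℝ, E) 𝓘(ℝ, E) (extChartAt 𝓘(ℝ, E) x₀).symm y).IsInvertible :=
    chartInvDeriv_isInvertible (E := E) (x₀ := x₀) hy
  have h2 := ContMDiffAt.mpullback_vectorField_preimage (m := ∞)
    (X.contMDiff ((extChartAt 𝓘(ℝ, E) x₀).symm y)) h1 hi (by simp)
  have h3 : ContDiffAt ℝ ∞ (localField x₀ X) y :=
    contMDiffAt_vectorSpace_iff_contDiffAt.1 h2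
  exact h3.contDiffWithinAt

theorem mlieBracket_eq_localField (X Y : VecField E M) (x : M) :
    mlieBracket 𝓘(ℝ, E) X Y x =
      lieBracket ℝ (localField x X) (localField x Y) (extChartAt 𝓘(ℝ, E) x x) := by
  let W : VecField E M → E → E := fun Z =>
    mpullbackWithin 𝓘(ℝ, E) 𝓘(ℝ, E) (extChartAt 𝓘(ℝ, E) x).symm Z (range 𝓘(ℝ, E))
  have hW : ∀ Z, W Z = localField x Z := fun Z => by
    simp only [W, modelWithCornersSelf_coe, range_id, mpullbackWithin_univ]; rfl
  have hs : (extChartAt 𝓘(ℝ, E) x).symm ⁻¹' univ ∩ range 𝓘(ℝ, E) = univ := by simp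
  have h : mlieBracket 𝓘(ℝ, E) X Y x = (chartDeriv x x).inverse
      (lieBracketWithin ℝ (W X) (W Y)
        ((extChartAt 𝓘(ℝ, E) x).symm ⁻¹' univ ∩ range 𝓘(ℝ, E)) (extChartAt 𝓘(ℝ, E) x x)) := rfl
  have h2 : (chartDeriv x x).inverse = ContinuousLinearMap.id ℝ E :=
    (congrArg ContinuousLinearMap.inverse (chartDeriv_self x)).trans ContinuousLinearMap.inverse_id
  rw [hs, lieBracketWithin_univ, hW, hW] at h
  exact h.trans (DFunLike.congr_fun h2 _)

/-- Change of charts for the coordinate expressions of a form. -/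
theorem localForm_change {k : ℕ} (α : PreForm E M F k) (x₀ z₀ : M) {y : E}
    (hy : y ∈ (extChartAt 𝓘(ℝ, E) x₀).target)
    (hz : (extChartAt 𝓘(ℝ, E) x₀).symm y ∈ (extChartAt 𝓘(ℝ, E) z₀).source) (w : Fin k → E) :
    localForm x₀ α y w = localForm z₀ α
      (extChartAt 𝓘(ℝ, E) z₀ ((extChartAt 𝓘(ℝ, E) x₀).symm y))
      (fun i => fderiv ℝ (extChartAt 𝓘(ℝ, E) z₀ ∘ (extChartAt 𝓘(ℝ, E) x₀).symm) y (w i)) := by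
  set φ := extChartAt 𝓘(ℝ, E) x₀ with hφ
  set ψ := extChartAt 𝓘(ℝ, E) z₀ with hψ
  have h1 : MDifferentiableAt 𝓘(ℝ, E) 𝓘(ℝ, E) φ.symm y :=
    ((contMDiffOn_extChartAt_symm (n := 1) x₀).contMDiffAt
      ((isOpen_extChartAt_target x₀).mem_nhds hy)).mdifferentiableAt (by simp)
  have h2 : MDifferentiableAt 𝓘(ℝ, E) 𝓘(ℝ, E) ψ (φ.symm y) :=
    mdifferentiableAt_extChartAt (by rwa [hψ, extChartAt_source] at hz)
  have hτ : ∀ v : E, fderiv ℝ (ψ ∘ φ.symm) y v =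
      chartDeriv z₀ (φ.symm y) (chartInvDeriv x₀ y v) := by
    intro v
    have h3 := mfderiv_comp y h2 h1
    rw [← mfderiv_eq_fderiv]
    exact DFunLike.congr_fun h3 v
  have hr : ψ.symm (ψ (φ.symm y)) = φ.symm y := ψ.left_inv hz
  -- transport along the equality of base points
  have key : ∀ (p q : M) (hpq : p = q) (u u' : Fin k → E), u = u' →
      (α p : E [⋀^Fin k]→ₗ[ℝ] F) u = (α q : E [⋀^Fin k]→ₗ[ℝ] F) u' := by
    rintro p _ rfl u _ rfl; rfl
  refine key _ _ hr.symm _ _ (funext fun i => ?_)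
  have h4 := hτ (w i)
  have h5 := chartDeriv_comp (x₀ := z₀) (y := ψ (φ.symm y)) (ψ.map_source hz)
    (fderiv ℝ (ψ ∘ φ.symm) y (w i))
  have h6 : ∀ (p q : M) (hpq : p = q) (a b : E),
      (chartDeriv z₀ p : E →L[ℝ] E) a = (chartDeriv z₀ q : E →L[ℝ] E) b → 
      q ∈ ψ.source → a = b := by
    rintro p _ rfl a b hab hp
    exact (isInvertible_mfderiv_extChartAt hp).injective hab
  exact (h6 _ _ hr _ _ (h5.trans h4) hz).symm

variable [T2Space F] [IsTopologicalAddGroup F] [ContinuousSMul ℝ F]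

variable (E M F) in
/-- The space `Ω^k(M, F)` of smooth `F`-valued `k`-forms: families of alternating forms whose
components in every chart are smooth. -/
def DiffForm (k : ℕ) : Submodule ℝ (PreForm E M F k) where
  carrier := {α | ∀ x₀ : M, IsSmoothFormOn (extChartAt 𝓘(ℝ, E) x₀).target (localForm x₀ α)}
  add_mem' {α β} hα hβ x₀ w n := (hα x₀ w n).add (isOpen_extChartAt_target x₀) (hβ x₀ w n)
  zero_mem' x₀ w := by
    have := IsSmoothOn.sum (F := F) (isOpen_extChartAt_target (I := 𝓘(ℝ, E)) x₀)
      (f := fun (_ : Empty) _ => 0) ∅ (by simp)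
    simp only [Finset.sum_empty] at this
    exact this
  smul_mem' c α hα x₀ w n := (hα x₀ w n).const_smul (isOpen_extChartAt_target x₀) c

theorem localForm_contract {k : ℕ} (x₀ : M) (X : VecField E M) (α : PreForm E M F (k + 1))
    {y : E} (hy : y ∈ (extChartAt 𝓘(ℝ, E) x₀).target) (w : Fin k → E) :
    localForm x₀ (fun x => (α x).curryLeft (X x) : PreForm E M F k) y w =
      localForm x₀ α y (Matrix.vecCons (localField x₀ X y) w) := by
  have h := chartInvDeriv_localField hy X
  have h1 : ∀ (p : M) (v : E) (u : E) (L : E →L[ℝ] E), L u = v →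
      (α p : E [⋀^Fin (k + 1)]→ₗ[ℝ] F) (Matrix.vecCons v fun i => L (w i)) =
      (α p : E [⋀^Fin (k + 1)]→ₗ[ℝ] F) (fun i => L (Matrix.vecCons u w i)) := by
    rintro p _ u L rfl
    congr 1
    funext i
    refine Fin.cases ?_ (fun i => ?_) i <;> rfl
  exact h1 _ _ _ _ h

/-- The interior product `i_X : Ω^{k+1}(M, F) → Ω^k(M, F)`, inserting `X` in the first slot. -/
noncomputable def interiorProd (X : VecField E M) {k : ℕ} : DiffForm E M F (k + 1) →ₗ[ℝ] DiffForm E M F k where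
  toFun α := ⟨fun x => (α.1 x).curryLeft (X x), fun x₀ w => by
    have hU := isOpen_extChartAt_target (I := 𝓘(ℝ, E)) x₀
    let b := Module.finBasis ℝ E
    have h1 : IsSmoothOn (extChartAt 𝓘(ℝ, E) x₀).target (fun y => ∑ j,
        b.repr (localField x₀ X y) j • localForm x₀ α.1 y (Matrix.vecCons (b j) w)) := by
      refine IsSmoothOn.sum hU _ fun j _ n => ?_
      refine IsCnOn.smul hU ?_ (α.2 x₀ _ n)
      refine isSmoothOn_of_contDiffOn hU ?_ n
      exact (LinearMap.toContinuousLinearMap (b.coord j)).contDiff.comp_contDiffOn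
        (localField_smooth x₀ X)
    refine h1.congr hU fun y hy => ?_
    rw [localForm_contract x₀ X α.1 hy]
    conv_rhs => rw [← b.sum_repr (localField x₀ X y)]
    let T : E →ₗ[ℝ] F :=
      { toFun := fun v => (localForm x₀ α.1 y).curryLeft v w
        map_add' := fun u v => by rw [map_add]; rfl
        map_smul' := fun c v => by rw [map_smul]; rfl }
    have h2 : T (∑ j, b.repr (localField x₀ X y) j • b j) =
        ∑ j, b.repr (localField x₀ X y) j • T (b j) := by simp only [map_sum, map_smul]
    exact h2.symm⟩
  map_add' α β := rfl
  map_smul' c α := rfl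

theorem localForm_center {k : ℕ} (x : M) (α : PreForm E M F k) (w : Fin k → E) :
    localForm x α (extChartAt 𝓘(ℝ, E) x x) w = (α x : E [⋀^Fin k]→ₗ[ℝ] F) w := by
  have h0 : ∀ v : E, (chartInvDeriv x (extChartAt 𝓘(ℝ, E) x x) : E →L[ℝ] E) v = v := by
    intro v
    have := mfderivWithin_range_extChartAt_symm (I := 𝓘(ℝ, E)) (x := x)
    rw [mfderivWithin_range_eq] at this
    exact DFunLike.congr_fun this v
  have key : ∀ (p q : M) (hpq : p = q) (u u' : Fin k → E), u = u' →
      (α p : E [⋀^Fin k]→ₗ[ℝ] F) u = (α q : E [⋀^Fin k]→ₗ[ℝ] F) u' := by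
    rintro p _ rfl u _ rfl; rfl
  exact key _ _ ((extChartAt 𝓘(ℝ, E) x).left_inv (mem_extChartAt_source x)) _ _
    (funext fun i => h0 (w i))

variable [LocallyConvexSpace ℝ F]

/-- The exterior derivative at the level of families of forms, computed at each point `x` in
the chart around `x`. -/
noncomputable def preExtDeriv {k : ℕ} (α : DiffForm E M F k) : PreForm E M F (k + 1) := fun x =>
  (altExtDeriv (localForm x α.1) (extChartAt 𝓘(ℝ, E) x x)
    ⟨_, isOpen_extChartAt_target x, mem_extChartAt_target x, α.2 x⟩).compLinearMap
    (chartDeriv x x).toLinearMap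

theorem preExtDeriv_apply {k : ℕ} (α : DiffForm E M F k) (x : M) (w : Fin (k + 1) → E) :
    (preExtDeriv α x : E [⋀^Fin (k + 1)]→ₗ[ℝ] F) w =
      extDerivFormula (localForm x α.1) (extChartAt 𝓘(ℝ, E) x x) w := by
  have h : ∀ v : E, (chartDeriv x x : E →L[ℝ] E) v = v := fun v =>
    DFunLike.congr_fun (chartDeriv_self x) v
  have h1 : (fun i => (chartDeriv x x : E →L[ℝ] E) (w i)) = w := funext fun i => h _
  exact congrArg (extDerivFormula (localForm x α.1) (extChartAt 𝓘(ℝ, E) x x)) h1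

/-- Independence of the chart: the exterior derivative is given in every chart by the usual
formula. -/
theorem localForm_preExtDeriv {k : ℕ} (α : DiffForm E M F k) (x₀ : M) {y : E}
    (hy : y ∈ (extChartAt 𝓘(ℝ, E) x₀).target) (w : Fin (k + 1) → E) :
    localForm x₀ (preExtDeriv α) y w = extDerivFormula (localForm x₀ α.1) y w := by
  set φ := extChartAt 𝓘(ℝ, E) x₀ with hφ
  set z := φ.symm y with hz
  set ψ := extChartAt 𝓘(ℝ, E) z with hψ
  set τ : E → E := ψ ∘ φ.symm with hτ
  have hzs : φ.symm y ∈ ψ.source := mem_extChartAt_source z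
  have hcφ : ContMDiffAt 𝓘(ℝ, E) 𝓘(ℝ, E) ∞ φ.symm y :=
    ((contMDiffOn_extChartAt_symm x₀).contMDiffAt ((isOpen_extChartAt_target x₀).mem_nhds hy))
  have hcψ : ContMDiffAt 𝓘(ℝ, E) 𝓘(ℝ, E) ∞ ψ (φ.symm y) := contMDiffAt_extChartAt
  have hcτ : ContDiffAt ℝ ∞ τ y := (hcψ.comp y hcφ).contDiffAt
  have hτy : τ y ∈ ψ.target := ψ.map_source hzs
  have hev : ∀ᶠ y' in 𝓝 y, y' ∈ φ.target ∧ φ.symm y' ∈ ψ.source :=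
    ((isOpen_extChartAt_target x₀).mem_nhds hy |> fun h => Filter.Eventually.and h
      (hcφ.continuousAt.preimage_mem_nhds ((isOpen_extChartAt_source z).mem_nhds hzs)))
  refine eq_of_forall_functional fun l => ?_
  have hUφ := isOpen_extChartAt_target (I := 𝓘(ℝ, E)) x₀
  have hUψ := isOpen_extChartAt_target (I := 𝓘(ℝ, E)) z
  rw [map_extDerivFormula hUφ (α.2 x₀) l hy]
  -- the right-hand side as a pullback
  have h1 : scalarForm l (localForm x₀ α.1) =ᶠ[𝓝 y] fun y' =>
      (scalarForm l (localForm z α.1) (τ y')).compContinuousLinearMap (fderiv ℝ τ y') := by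
    filter_upwards [hev] with y' hy'
    ext v
    exact congrArg l (localForm_change α.1 x₀ z hy'.1 hy'.2 v)
  rw [h1.extDeriv_eq, extDeriv_pullback (r := ∞)
    ((((α.2 z).scalarForm hUψ l).differentiableOn (by simp)).differentiableAt
      (hUψ.mem_nhds hτy)) hcτ
    (by rw [minSmoothness_of_isRCLikeNormedField]; exact ENat.LEInfty.out)]
  rw [ContinuousAlternatingMap.compContinuousLinearMap_apply,
    ← map_extDerivFormula hUψ (α.2 z) l hτy]
  congr 1
  rw [localForm_change (preExtDeriv α) x₀ z hy hzs]
  refine (localForm_center z (preExtDeriv α) _).trans ?_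
  exact preExtDeriv_apply α z _

theorem DiffForm.ext' {k : ℕ} {α β : DiffForm E M F k}
    (h : ∀ (x : M) (w : Fin k → E), (α.1 x : E [⋀^Fin k]→ₗ[ℝ] F) w =
      (β.1 x : E [⋀^Fin k]→ₗ[ℝ] F) w) : α = β :=
  Subtype.ext (funext fun x => AlternatingMap.ext fun w => h x w)

/-- The exterior derivative `d : Ω^k(M, F) → Ω^{k+1}(M, F)`. -/
noncomputable def extD {k : ℕ} : DiffForm E M F k →ₗ[ℝ] DiffForm E M F (k + 1) where
  toFun α := ⟨preExtDeriv α, fun x₀ w => by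
    have hU := isOpen_extChartAt_target (I := 𝓘(ℝ, E)) x₀
    refine IsSmoothOn.congr hU (f := fun y => extDerivFormula (localForm x₀ α.1) y w) ?_
      fun y hy => (localForm_preExtDeriv α x₀ hy w).symm
    exact IsSmoothOn.sum hU _ fun i _ n => (((α.2 x₀ _).dirDeriv (w i)) n).const_smul hU _⟩
  map_add' α β := DiffForm.ext' fun x w => by
    have hx : extChartAt 𝓘(ℝ, E) x x ∈ (extChartAt 𝓘(ℝ, E) x).target := mem_extChartAt_target x
    refine (preExtDeriv_apply _ x w).trans (Eq.trans ?_ (congrArg₂ (· + ·)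
      (preExtDeriv_apply α x w) (preExtDeriv_apply β x w)).symm)
    simp only [extDerivFormula, ← Finset.sum_add_distrib, ← smul_add]
    refine Finset.sum_congr rfl fun i _ => congrArg _ ?_
    exact (((α.2 x _).hasDirDeriv hx (w i)).add ((β.2 x _).hasDirDeriv hx (w i))).dirDeriv_eq
  map_smul' c α := DiffForm.ext' fun x w => by
    have hx : extChartAt 𝓘(ℝ, E) x x ∈ (extChartAt 𝓘(ℝ, E) x).target := mem_extChartAt_target x
    refine (preExtDeriv_apply _ x w).trans (Eq.trans ?_ (congrArg (c • ·)
      (preExtDeriv_apply α x w)).symm)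
    simp only [extDerivFormula, Finset.smul_sum]
    refine Finset.sum_congr rfl fun i _ => ?_
    rw [smul_comm c]
    refine congrArg _ ?_
    exact ((α.2 x _).hasDirDeriv hx (w i)).const_smul c |>.dirDeriv_eq

/-- The Lie derivative `L_X = i_X ∘ d + d ∘ i_X` on `Ω^k(M, F)`, where `i_X = 0` on
`Ω^0(M, F)`. -/
noncomputable def lieDer (X : VecField E M) :
    (k : ℕ) → DiffForm E M F k →ₗ[ℝ] DiffForm E M F k
  | 0 => interiorProd X ∘ₗ extD
  | _ + 1 => interiorProd X ∘ₗ extD + extD ∘ₗ interiorProd X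

theorem scalarForm_extD {k : ℕ} (l : F →L[ℝ] ℝ) (α : DiffForm E M F k) (x : M) {y : E}
    (hy : y ∈ (extChartAt 𝓘(ℝ, E) x).target) :
    scalarForm l (localForm x (extD α).1) y = extDeriv (scalarForm l (localForm x α.1)) y := by
  ext w
  rw [scalarForm_apply]
  exact (congrArg l (localForm_preExtDeriv α x hy w)).trans
    (map_extDerivFormula (isOpen_extChartAt_target x) (α.2 x) l hy w)

theorem scalarForm_interiorProd {k : ℕ} (l : F →L[ℝ] ℝ) (X : VecField E M)
    (α : DiffForm E M F (k + 1)) (x : M) {y : E} (hy : y ∈ (extChartAt 𝓘(ℝ, E) x).target) :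
    scalarForm l (localForm x (interiorProd X α).1) y =
      contractForm (localField x X) (scalarForm l (localForm x α.1)) y := by
  ext w
  exact congrArg l (localForm_contract x X α.1 hy w)

theorem DiffForm.ext_scalar {k : ℕ} {α β : DiffForm E M F k}
    (h : ∀ (l : F →L[ℝ] ℝ) (x : M) (w : Fin k → E),
      scalarForm l (localForm x α.1) (extChartAt 𝓘(ℝ, E) x x) w =
      scalarForm l (localForm x β.1) (extChartAt 𝓘(ℝ, E) x x) w) : α = β := by
  refine DiffForm.ext' fun x w => eq_of_forall_functional fun l => ?_
  have h1 := h l x w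
  rw [scalarForm_apply, scalarForm_apply, localForm_center, localForm_center] at h1
  exact h1

theorem DiffForm.differentiableAt {k : ℕ} (α : DiffForm E M F k) (l : F →L[ℝ] ℝ) (x : M) {y : E}
    (hy : y ∈ (extChartAt 𝓘(ℝ, E) x).target) :
    DifferentiableAt ℝ (scalarForm l (localForm x α.1)) y :=
  (((α.2 x).scalarForm (isOpen_extChartAt_target x) l).differentiableOn
    (by simp)).differentiableAt ((isOpen_extChartAt_target x).mem_nhds hy)

theorem localField_differentiableAt (X : VecField E M) (x : M) {y : E}
    (hy : y ∈ (extChartAt 𝓘(ℝ, E) x).target) : DifferentiableAt ℝ (localField x X) y :=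
  ((localField_smooth x X).differentiableOn (by simp)).differentiableAt
    ((isOpen_extChartAt_target x).mem_nhds hy)

theorem extD_extD {k : ℕ} (α : DiffForm E M F k) : extD (extD α) = 0 := by
  refine DiffForm.ext_scalar fun l x w => ?_
  have hx : extChartAt 𝓘(ℝ, E) x x ∈ (extChartAt 𝓘(ℝ, E) x).target := mem_extChartAt_target x
  have hU := isOpen_extChartAt_target (I := 𝓘(ℝ, E)) x
  have h1 : scalarForm l (localForm x (extD α).1) =ᶠ[𝓝 (extChartAt 𝓘(ℝ, E) x x)]
      extDeriv (scalarForm l (localForm x α.1)) := by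
    filter_upwards [hU.mem_nhds hx] with y hy using scalarForm_extD l α x hy
  rw [scalarForm_extD l _ x hx, h1.extDeriv_eq, extDeriv_extDeriv_apply (r := ∞)
    (((α.2 x).scalarForm hU l).contDiffAt (hU.mem_nhds hx))
    (by rw [minSmoothness_of_isRCLikeNormedField]; exact ENat.LEInfty.out)]
  exact (map_zero l).symm

/-- The Lie derivative in coordinates. -/
theorem scalarForm_lieDer {k : ℕ} (l : F →L[ℝ] ℝ) (X : VecField E M) (α : DiffForm E M F k)
    (x : M) {y : E} (hy : y ∈ (extChartAt 𝓘(ℝ, E) x).target) (w : Fin k → E) :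
    scalarForm l (localForm x (lieDer X k α).1) y w =
      lieFormula (localField x X) (scalarForm l (localForm x α.1)) y w := by
  have hU := isOpen_extChartAt_target (I := 𝓘(ℝ, E)) x
  have h1 : ∀ w, scalarForm l (localForm x (interiorProd X (extD α)).1) y w =
      extDeriv (scalarForm l (localForm x α.1)) y (Matrix.vecCons (localField x X y) w) := by
    intro w
    rw [scalarForm_interiorProd l X _ x hy, contractForm, scalarForm_extD l α x hy]
    rfl
  cases k with
  | zero =>
    exact (h1 w).trans (extDeriv_zero_form (DiffForm.differentiableAt α l x hy) w)
  | succ k =>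
    rw [← cartan_formula (DiffForm.differentiableAt α l x hy) (localField_differentiableAt X x hy), ← h1]
    have h2 : scalarForm l (localForm x (interiorProd X α).1) =ᶠ[𝓝 y]
        contractForm (localField x X) (scalarForm l (localForm x α.1)) := by
      filter_upwards [hU.mem_nhds hy] with y hy using scalarForm_interiorProd l X α x hy
    rw [← h2.extDeriv_eq, ← scalarForm_extD l _ x hy]
    exact map_add l _ _

/-- Smooth vector fields form a Lie ring under the Lie bracket of vector fields. -/
noncomputable instance : LieRing (VecField E M) where
  bracket X Y := ⟨mlieBracket 𝓘(ℝ, E) X Y, by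
    have : CompleteSpace E := FiniteDimensional.complete ℝ E
    have h2 : minSmoothness ℝ 2 ≤ (∞ : WithTop ℕ∞) := by
      rw [minSmoothness_of_isRCLikeNormedField]; exact ENat.LEInfty.out
    have : IsManifold 𝓘(ℝ, E) (minSmoothness ℝ 2) M := IsManifold.of_le h2
    have : IsManifold 𝓘(ℝ, E) ((⊤ : ℕ∞) + 1) M := IsManifold.of_le (n := ∞) (by simp)
    exact ContDiff.mlieBracket_vectorField (m := ⊤) (n := ⊤) X.contMDiff Y.contMDiff (by simp)⟩
  add_lie X Y Z := by
    ext x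
    exact mlieBracket_add_left (X.contMDiff.mdifferentiable (by simp) x)
      (Y.contMDiff.mdifferentiable (by simp) x)
  lie_add X Y Z := by
    ext x
    exact mlieBracket_add_right (Y.contMDiff.mdifferentiable (by simp) x)
      (Z.contMDiff.mdifferentiable (by simp) x)
  lie_self X := by
    ext x
    exact congrFun (mlieBracket_self (V := X)) x
  leibniz_lie X Y Z := by
    have : CompleteSpace E := FiniteDimensional.complete ℝ E
    ext x
    have h3 : minSmoothness ℝ 3 ≤ (∞ : WithTop ℕ∞) := by
      rw [minSmoothness_of_isRCLikeNormedField]; exact ENat.LEInfty.out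
    have h2 : minSmoothness ℝ 2 ≤ (∞ : WithTop ℕ∞) := by
      rw [minSmoothness_of_isRCLikeNormedField]; exact ENat.LEInfty.out
    have : IsManifold 𝓘(ℝ, E) (minSmoothness ℝ 3) M := IsManifold.of_le h3
    exact leibniz_identity_mlieBracket_apply ((X.contMDiff x).of_le h2)
      ((Y.contMDiff x).of_le h2) ((Z.contMDiff x).of_le h2)

noncomputable instance : LieAlgebra ℝ (VecField E M) where
  lie_smul c X Y := by
    ext x
    exact mlieBracket_const_smul_right (Y.contMDiff.mdifferentiable (by simp) x)

theorem lie_vecField_apply (X Y : VecField E M) (x : M) :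
    ⁅X, Y⁆ x = mlieBracket 𝓘(ℝ, E) X Y x := rfl

theorem localField_center (Z : VecField E M) (x : M) :
    localField x Z (extChartAt 𝓘(ℝ, E) x x) = Z x := by
  have h0 : ∀ v : E, (chartInvDeriv x (extChartAt 𝓘(ℝ, E) x x) : E →L[ℝ] E) v = v := by
    intro v
    have := mfderivWithin_range_extChartAt_symm (I := 𝓘(ℝ, E)) (x := x)
    rw [mfderivWithin_range_eq] at this
    exact DFunLike.congr_fun this v
  have h1 := chartInvDeriv_localField (mem_extChartAt_target (I := 𝓘(ℝ, E)) x) Z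
  have key : ∀ p q : M, p = q → (Z p : E) = (Z q : E) := by rintro p _ rfl; rfl
  exact ((h0 _).symm.trans h1).trans
    (key _ _ ((extChartAt 𝓘(ℝ, E) x).left_inv (mem_extChartAt_source x)))

/-- `[L_X, i_Y] = i_{[X, Y]}`. -/
theorem lieDer_interiorProd (X Y : VecField E M) {k : ℕ} (α : DiffForm E M F (k + 1)) :
    lieDer X k (interiorProd Y α) =
      interiorProd ⁅X, Y⁆ α + interiorProd Y (lieDer X (k + 1) α) := by
  refine DiffForm.ext_scalar fun l x w => ?_
  have hx : extChartAt 𝓘(ℝ, E) x x ∈ (extChartAt 𝓘(ℝ, E) x).target := mem_extChartAt_target x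
  have hU := isOpen_extChartAt_target (I := 𝓘(ℝ, E)) x
  have h0 : scalarForm l (localForm x (interiorProd Y α).1) =ᶠ[𝓝 (extChartAt 𝓘(ℝ, E) x x)]
      contractForm (localField x Y) (scalarForm l (localForm x α.1)) := by
    filter_upwards [hU.mem_nhds hx] with y hy using scalarForm_interiorProd l Y α x hy
  have h1 : lieFormula (localField x X) (scalarForm l (localForm x (interiorProd Y α).1))
      (extChartAt 𝓘(ℝ, E) x x) w = lieFormula (localField x X)
        (contractForm (localField x Y) (scalarForm l (localForm x α.1)))
        (extChartAt 𝓘(ℝ, E) x x) w := by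
    simp only [lieFormula, h0.fderiv_eq, h0.self_of_nhds]
  have h2 := lieFormula_contract (X := localField x X) (DiffForm.differentiableAt α l x hx)
    (localField_differentiableAt Y x hx) w
  have h3 : localField x ⁅X, Y⁆ (extChartAt 𝓘(ℝ, E) x x) =
      lieBracket ℝ (localField x X) (localField x Y) (extChartAt 𝓘(ℝ, E) x x) := by
    rw [← mlieBracket_eq_localField]
    exact localField_center ⁅X, Y⁆ x
  have h4 : scalarForm l (localForm x (interiorProd ⁅X, Y⁆ α + interiorProd Y
      (lieDer X (k + 1) α)).1) (extChartAt 𝓘(ℝ, E) x x) w =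
      scalarForm l (localForm x (interiorProd ⁅X, Y⁆ α).1) (extChartAt 𝓘(ℝ, E) x x) w +
      scalarForm l (localForm x (interiorProd Y (lieDer X (k + 1) α)).1)
        (extChartAt 𝓘(ℝ, E) x x) w := map_add l _ _
  have h5 : scalarForm l (localForm x (interiorProd ⁅X, Y⁆ α).1) (extChartAt 𝓘(ℝ, E) x x) w =
      scalarForm l (localForm x α.1) (extChartAt 𝓘(ℝ, E) x x) (Matrix.vecCons
        (localField x ⁅X, Y⁆ (extChartAt 𝓘(ℝ, E) x x)) w) := by
    rw [scalarForm_interiorProd l _ α x hx]; rfl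
  have h6 : scalarForm l (localForm x (interiorProd Y (lieDer X (k + 1) α)).1)
      (extChartAt 𝓘(ℝ, E) x x) w = lieFormula (localField x X) (scalarForm l (localForm x α.1))
        (extChartAt 𝓘(ℝ, E) x x) (Matrix.vecCons
          (localField x Y (extChartAt 𝓘(ℝ, E) x x)) w) := by
    rw [scalarForm_interiorProd l _ _ x hx, ← scalarForm_lieDer l X α x hx]; rfl
  rw [scalarForm_lieDer l X _ x hx, h1, h4, h5, h6, h3]
  linarith

theorem extD_lieDer (X : VecField E M) {k : ℕ} (α : DiffForm E M F k) :
    extD (lieDer X k α) = lieDer X (k + 1) (extD α) := by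
  cases k with
  | zero => simp [lieDer, extD_extD]
  | succ k => simp [lieDer, extD_extD]

theorem lieDer_lie (X Y : VecField E M) {k : ℕ} (α : DiffForm E M F k) :
    lieDer ⁅X, Y⁆ k α = lieDer X k (lieDer Y k α) - lieDer Y k (lieDer X k α) := by
  have h1 : ∀ {m : ℕ} (β : DiffForm E M F (m + 1)), interiorProd ⁅X, Y⁆ β =
      lieDer X m (interiorProd Y β) - interiorProd Y (lieDer X (m + 1) β) := fun β => by
    rw [lieDer_interiorProd]; abel
  cases k with
  | zero =>
    change interiorProd ⁅X, Y⁆ (extD α) =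
      lieDer X 0 (interiorProd Y (extD α)) - interiorProd Y (extD (lieDer X 0 α))
    rw [h1, extD_lieDer]
  | succ k =>
    change interiorProd ⁅X, Y⁆ (extD α) + extD (interiorProd ⁅X, Y⁆ α) =
      lieDer X (k + 1) (interiorProd Y (extD α) + extD (interiorProd Y α)) -
      (interiorProd Y (extD (lieDer X (k + 1) α)) + extD (interiorProd Y (lieDer X (k + 1) α)))
    rw [h1, h1, map_sub, map_add, extD_lieDer, extD_lieDer]
    abel

theorem interiorProd_add_left (X Y : VecField E M) {k : ℕ} (α : DiffForm E M F (k + 1)) :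
    interiorProd (X + Y) α = interiorProd X α + interiorProd Y α :=
  Subtype.ext (funext fun x => map_add (α.1 x).curryLeft (X x) (Y x))

theorem interiorProd_smul_left (c : ℝ) (X : VecField E M) {k : ℕ}
    (α : DiffForm E M F (k + 1)) : interiorProd (c • X) α = c • interiorProd X α :=
  Subtype.ext (funext fun x => map_smul (α.1 x).curryLeft c (X x))

theorem interiorProd_self (X : VecField E M) {k : ℕ} (α : DiffForm E M F (k + 2)) :
    interiorProd X (interiorProd X α) = 0 :=
  Subtype.ext (funext fun x => AlternatingMap.curryLeft_same (α.1 x) (X x))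

/-- `Ω^k(M, F)` is a module of the Lie algebra of vector fields, which acts by the
Lie derivative. -/
noncomputable instance (k : ℕ) : LieRingModule (VecField E M) (DiffForm E M F k) where
  bracket X α := lieDer X k α
  add_lie X Y α := by
    cases k with
    | zero => simp [lieDer, interiorProd_add_left]
    | succ k => simp [lieDer, interiorProd_add_left]; abel
  lie_add X α β := map_add _ _ _
  leibniz_lie X Y α := by rw [lieDer_lie]; abel

theorem lie_diffForm (X : VecField E M) {k : ℕ} (α : DiffForm E M F k) :
    ⁅X, α⁆ = lieDer X k α := rfl

noncomputable instance (k : ℕ) : LieModule ℝ (VecField E M) (DiffForm E M F k) where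
  smul_lie c X α := by
    cases k with
    | zero => simp [lie_diffForm, lieDer, interiorProd_smul_left]
    | succ k => simp [lie_diffForm, lieDer, interiorProd_smul_left]
  lie_smul c X α := map_smul _ _ _

variable (E M F) in
/-- The space of exact `k`-forms `d Ω^{k-1}(M, F)`, with `d Ω^{-1}(M, F) = 0`. -/
noncomputable def exactForms : (k : ℕ) → LieSubmodule ℝ (VecField E M) (DiffForm E M F k)
  | 0 => ⊥
  | k + 1 =>
    { toSubmodule := LinearMap.range (extD : DiffForm E M F k →ₗ[ℝ] DiffForm E M F (k + 1))
      lie_mem := by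
        rintro X _ ⟨θ, rfl⟩
        exact ⟨lieDer X k θ, extD_lieDer X θ⟩ }

variable (E M F) in
/-- The module `Ω^p(M, F) / d Ω^{p-1}(M, F)` of the Lie algebra of vector fields. -/
abbrev FormsModExact (p : ℕ) : Type _ := DiffForm E M F p ⧸ exactForms E M F p

/-- The class `[α]` of a form modulo exact forms. -/
noncomputable abbrev formClass {p : ℕ} : DiffForm E M F p →ₗ[ℝ] FormsModExact E M F p :=
  (exactForms E M F p).toSubmodule.mkQ

open LieModule.Cohomology

/-- The `2`-cochain `ω(X, Y) = [i_Y i_X ω']` of the Lie algebra of vector fields with values in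
`Ω^p(M, F) / d Ω^{p-1}(M, F)` defined by a `(p + 2)`-form `ω'`. -/
noncomputable def formCochain {p : ℕ} (ω' : DiffForm E M F (p + 2)) :
    twoCochain ℝ (VecField E M) (FormsModExact E M F p) where
  val := LinearMap.mk₂ ℝ (fun X Y => formClass (interiorProd Y (interiorProd X ω')))
    (fun X X' Y => by rw [interiorProd_add_left, map_add, map_add])
    (fun c X Y => by rw [interiorProd_smul_left, map_smul, map_smul])
    (fun X Y Y' => by rw [interiorProd_add_left, map_add])
    (fun c X Y => by rw [interiorProd_smul_left, map_smul])
  property X := by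
    rw [LinearMap.mk₂_apply, interiorProd_self, map_zero]

/-- The symplectic vector fields `{X | L_X ω' = 0, i_X dω' = 0}` of a form `ω'`. -/
def symplecticFields {k : ℕ} (ω' : DiffForm E M F (k + 1)) : Set (VecField E M) :=
  {X | lieDer X (k + 1) ω' = 0 ∧ interiorProd X (extD ω') = 0}

/-- The hamiltonian vector fields of a form `ω'`: those symplectic `X` for which `i_X ω'`
is exact. -/
def hamiltonianFields {k : ℕ} (ω' : DiffForm E M F (k + 2)) : Set (VecField E M) :=
  {X | X ∈ symplecticFields ω' ∧ ∃ θ : DiffForm E M F k, interiorProd X ω' = extD θ}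

end ManifoldForms

/-! Both cochain conditions say that certain `p`-forms obtained by repeated contraction are exact,
and exactness has to be promoted to vanishing. The bridge is a rigidity statement,
`forall_formClass_interiorProd_eq_zero_iff`: if `α` has positive degree and `i_Z α` is exact for
every vector field `Z`, then `α = 0`. Exact forms are closed, so it suffices that `d(i_Z α) = 0` for
all `Z` forces `α = 0` (`eq_zero_of_forall_extD_interiorProd`). At a point `x`, take `Z` vanishing
at `x` with linear part the rank-one map `u ↦ m(u) v`. The derivative of `α` then drops out of
`d(i_Z α)` at `x`, leaving `∑ (-1)^i m(w_i) α(v, w_0, …, ŵ_i, …)`. For linearly independent `w`, the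
choice `v = w_0` and `m` nonzero on `w_0` but zero on the other `w_i` gives `α(w) = 0`.

The rest is Cartan calculus modulo exact forms. On classes `L_Z β` and `i_Z dβ` agree, and `[L_X,
i_Y] = i_{[X, Y]}`. Hence the coboundary of the cochain of `ω'` sends `(X, Y, Z)` to `[i_Z i_Y i_X
dω']` (`d₂₃_formCochain`), and the Lie derivative of this cochain along `X` is the cochain of `L_X
ω'` (`lie_formCochain`). Rigidity, applied in degree `p + 1` to what remains before the last
contraction, turns these identities into (a) and (b). For (c), the equation `[i_Z i_X ω'] = Z.[θ]`
for all `Z` says that `i_Z (i_X ω' - dθ)` is exact for all `Z`, so `i_X ω' = dθ`. -/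

section TopDegree

variable {E : Type*} [NormedAddCommGroup E] [NormedSpace ℝ E]

/-! ### Linear algebra: alternating forms tested against rank-one endomorphisms. -/

/-- An alternating form which is annihilated by all the rank-one derivations `l ⊗ v` vanishes
if the number of its arguments is positive. -/
theorem ContinuousAlternatingMap.eq_zero_of_forall_sum_eq_zero {k : ℕ}
    (B : E [⋀^Fin (k + 1)]→L[ℝ] ℝ)
    (h : ∀ (l : Module.Dual ℝ E) (v : E) (w : Fin (k + 1) → E),
      ∑ i : Fin (k + 1), (-1 : ℤ) ^ (i : ℕ) • (l (w i) * B (Matrix.vecCons v (i.removeNth w))) = 0) :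
    B = 0 := by
  ext w
  by_cases hw : LinearIndependent ℝ w
  · have hw' : LinearIndependent ℝ (Fin.cons (w 0) (Fin.tail w) : Fin (k + 1) → E) := by
      rwa [Fin.cons_self_tail]
    -- Independence puts `w 0` outside the span of the other vectors, so some functional is nonzero
    -- on `w 0` and kills that span. With `v = w 0`, only the term `i = 0` of the sum survives.
    obtain ⟨l, hl0, hl⟩ := Submodule.exists_dual_map_eq_bot_of_notMem
      (linearIndependent_finCons.1 hw').2 inferInstance
    have hl1 : ∀ i : Fin k, l (w i.succ) = 0 := fun i => by
      have h1 : l (w i.succ) ∈ (Submodule.span ℝ (range (Fin.tail w))).map l :=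
        Submodule.mem_map_of_mem (Submodule.subset_span ⟨i, rfl⟩)
      rwa [hl, Submodule.mem_bot] at h1
    have h1 := h l (w 0) w
    rw [Fin.sum_univ_succ] at h1
    simp only [hl1, zero_mul, smul_zero, Finset.sum_const_zero, add_zero, Fin.val_zero, pow_zero,
      one_smul, mul_eq_zero, hl0, false_or] at h1
    have h2 : Matrix.vecCons (w 0) ((0 : Fin (k + 1)).removeNth w) = w := by
      rw [Fin.removeNth_zero]
      exact Fin.cons_self_tail w
    rwa [h2] at h1
  · exact B.toAlternatingMap.map_linearDependent w hw

end TopDegree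

/-! ### Vector fields with prescribed germ, and rigidity of forms under contraction. -/

section ManifoldForms

open VectorField

variable {E M F : Type*} [NormedAddCommGroup E] [NormedSpace ℝ E] [FiniteDimensional ℝ E]
  [TopologicalSpace M] [ChartedSpace E M] [IsManifold 𝓘(ℝ, E) ∞ M]
  [AddCommGroup F] [Module ℝ F] [TopologicalSpace F]

/-- Every smooth vector field in coordinates around `x` is near `x` the coordinate expression of
a vector field on `M`. -/
theorem exists_localField_eventuallyEq [T2Space M] (x : M) {g : E → E} (hg : ContDiff ℝ ∞ g) :
    ∃ Z : VecField E M, localField x Z =ᶠ[𝓝 (extChartAt 𝓘(ℝ, E) x x)] g := by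
  obtain ⟨f⟩ : Nonempty (SmoothBumpFunction 𝓘(ℝ, E) x) := inferInstance
  -- `W` is `g` transported to the chart domain; multiplied by a bump function supported there, it
  -- extends by zero to a smooth field on all of `M`.
  let W : (p : M) → TangentSpace 𝓘(ℝ, E) p :=
    mpullback 𝓘(ℝ, E) 𝓘(ℝ, E) (extChartAt 𝓘(ℝ, E) x) (V := g)
  have hinv : ∀ p ∈ (extChartAt 𝓘(ℝ, E) x).source,
      (mfderiv 𝓘(ℝ, E) 𝓘(ℝ, E) (extChartAt 𝓘(ℝ, E) x) p).IsInvertible := fun p hp =>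
    isInvertible_mfderiv_extChartAt hp
  have hW : ContMDiffOn 𝓘(ℝ, E) (𝓘(ℝ, E).prod 𝓘(ℝ, E)) ∞
      (fun p => (⟨p, W p⟩ : TangentBundle 𝓘(ℝ, E) M)) (extChartAt 𝓘(ℝ, E) x).source := by
    intro p hp
    have hp' : p ∈ (chartAt E x).source := by rwa [extChartAt_source] at hp
    have h1 : ContMDiffAt 𝓘(ℝ, E) 𝓘(ℝ, E) ∞ (extChartAt 𝓘(ℝ, E) x) p :=
      contMDiffAt_extChartAt' hp'
    exact (ContMDiffAt.mpullback_vectorField_preimage (m := ∞)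
      (contMDiffAt_vectorSpace_iff_contDiffAt.2 hg.contDiffAt) h1 (hinv p hp)
      (by simp)).contMDiffWithinAt
  refine ⟨⟨(f : M → ℝ) • W, ContMDiffOn.smul_section_of_tsupport f.contMDiff.contMDiffOn
    (isOpen_extChartAt_source x) f.tsupport_subset_extChartAt_source hW⟩, ?_⟩
  have hc : ContinuousAt (extChartAt 𝓘(ℝ, E) x).symm (extChartAt 𝓘(ℝ, E) x x) :=
    continuousAt_extChartAt_symm x
  have hc' : Tendsto (extChartAt 𝓘(ℝ, E) x).symm (𝓝 (extChartAt 𝓘(ℝ, E) x x)) (𝓝 x) := by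
    have := hc.tendsto
    rwa [extChartAt_to_inv] at this
  filter_upwards [hc'.eventually f.eventuallyEq_one, (isOpen_extChartAt_target x).mem_nhds
    (mem_extChartAt_target (I := 𝓘(ℝ, E)) x)] with y hy hyt
  have hs := (extChartAt 𝓘(ℝ, E) x).map_target hyt
  -- Applying the tangent maps of the inverse chart and then of the chart, both injective, moves the
  -- comparison to values of the fields on `M`. There the bump function is `1`, and the pullback
  -- defining `W` cancels against the chart derivative.
  apply (chartInvDeriv_isInvertible hyt).injective
  rw [chartInvDeriv_localField hyt]
  apply (hinv _ hs).injective
  refine Eq.trans ?_ (chartDeriv_comp hyt (g y)).symm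
  have h1 : ((f : M → ℝ) • W) ((extChartAt 𝓘(ℝ, E) x).symm y) =
      W ((extChartAt 𝓘(ℝ, E) x).symm y) := by
    rw [Pi.smul_apply', hy, Pi.one_apply, one_smul]
  refine (congrArg _ h1).trans (((hinv _ hs).self_apply_inverse _).trans ?_)
  exact congrArg g ((extChartAt 𝓘(ℝ, E) x).right_inv hyt)

variable [T2Space F] [IsTopologicalAddGroup F] [ContinuousSMul ℝ F] [LocallyConvexSpace ℝ F]

/-- A form of positive degree all of whose contractions with vector fields are closed vanishes. -/
theorem eq_zero_of_forall_extD_interiorProd [T2Space M] {k : ℕ} {α : DiffForm E M F (k + 1)}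
    (h : ∀ Z : VecField E M, extD (interiorProd Z α) = 0) : α = 0 := by
  -- Continuous functionals separate the points of `F`, so the claim reduces to the real-valued
  -- coordinate form `B`.
  refine DiffForm.ext_scalar fun l x w => ?_
  have hx : extChartAt 𝓘(ℝ, E) x x ∈ (extChartAt 𝓘(ℝ, E) x).target := mem_extChartAt_target x
  have hU := isOpen_extChartAt_target (I := 𝓘(ℝ, E)) x
  set x₀ := extChartAt 𝓘(ℝ, E) x x with hx₀
  set B := scalarForm l (localForm x α.1) with hB
  have hBd : DifferentiableAt ℝ B x₀ := DiffForm.differentiableAt α l x hx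
  suffices B x₀ = 0 by
    rw [this]
    exact (map_zero l).symm
  refine (B x₀).eq_zero_of_forall_sum_eq_zero fun m v w => ?_
  -- The test field is `y ↦ A (y - x₀)` with `A u = m(u) v`: it vanishes at `x₀` and has derivative
  -- `A` there.
  let A : E →L[ℝ] E := (LinearMap.toContinuousLinearMap m).smulRight v
  have hg : ContDiff ℝ ∞ (fun y => A (y - x₀)) := A.contDiff.comp (contDiff_id.sub contDiff_const)
  have hg' : HasFDerivAt (fun y => A (y - x₀)) A x₀ :=
    A.hasFDerivAt.comp x₀ ((hasFDerivAt_id x₀).sub_const x₀)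
  obtain ⟨Z, hZ⟩ := exists_localField_eventuallyEq (M := M) x hg
  have h1 : scalarForm l (localForm x (interiorProd Z α).1) =ᶠ[𝓝 x₀]
      contractForm (fun y => A (y - x₀)) B := by
    filter_upwards [hU.mem_nhds hx, hZ] with y hy hZy
    rw [scalarForm_interiorProd l Z α x hy, contractForm, contractForm, hZy]
  have h2 : extDeriv (contractForm (fun y => A (y - x₀)) B) x₀ w = 0 := by
    rw [← h1.extDeriv_eq, ← scalarForm_extD l _ x hx, h Z]
    exact map_zero l
  obtain ⟨h3, h4⟩ := hasFDerivAt_contractForm hBd hg'.differentiableAt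
  rw [extDeriv_apply h3] at h2
  rw [← h2]
  refine Finset.sum_congr rfl fun i _ => ?_
  rw [fderiv_continuousAlternatingMap_apply_const_apply h3, h4, hg'.fderiv]
  congr 1
  -- By the product rule the derivative of `B` is paired with the value of the test field at `x₀`,
  -- which is zero; only the derivative `A` of the field contributes.
  have h5 : fderiv ℝ B x₀ (w i) (Matrix.vecCons (A (x₀ - x₀)) (i.removeNth w)) = 0 :=
    ContinuousAlternatingMap.map_coord_zero _ 0 (by simp)
  rw [h5, zero_add]
  change m (w i) * (B x₀).curryLeft v (i.removeNth w) =
    (B x₀).curryLeft (m (w i) • v) (i.removeNth w)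
  rw [map_smul]
  rfl

/-! ### Calculus with classes modulo exact forms. -/

theorem formClass_extD {p : ℕ} (θ : DiffForm E M F p) :
    formClass (extD θ) = (0 : FormsModExact E M F (p + 1)) :=
  (Submodule.Quotient.mk_eq_zero _).2 ⟨θ, rfl⟩

/-- Exact forms are closed by `d² = 0`. Degree `0` is separate: there the convention `dΩ^{-1} = 0`
leaves only the zero form, so nonzero constants are not exact. -/
theorem extD_eq_zero_of_formClass_eq_zero {p : ℕ} {β : DiffForm E M F p}
    (h : formClass β = (0 : FormsModExact E M F p)) : extD β = 0 := by
  have h1 : β ∈ exactForms E M F p := (Submodule.Quotient.mk_eq_zero _).1 h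
  cases p with
  | zero =>
    have h2 : β = 0 := h1
    rw [h2, map_zero]
  | succ p =>
    obtain ⟨θ, rfl⟩ := h1
    exact extD_extD θ

/-- In Cartan's formula the term `d i_X β` is exact and disappears in the quotient. In degree `0`
that term is absent from the start. -/
theorem formClass_lieDer (X : VecField E M) {p : ℕ} (β : DiffForm E M F p) :
    formClass (lieDer X p β) = (formClass (interiorProd X (extD β)) : FormsModExact E M F p) := by
  cases p with
  | zero => rfl
  | succ p =>
    change formClass (interiorProd X (extD β) + extD (interiorProd X β)) = _
    rw [map_add, formClass_extD, add_zero]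

theorem lie_formClass (X : VecField E M) {p : ℕ} (β : DiffForm E M F p) :
    ⁅X, (formClass β : FormsModExact E M F p)⁆ = formClass (lieDer X p β) := rfl

/-- A form of positive degree all of whose contractions with vector fields are exact vanishes. -/
theorem forall_formClass_interiorProd_eq_zero_iff [T2Space M] {p : ℕ}
    {α : DiffForm E M F (p + 1)} :
    (∀ Z : VecField E M, formClass (interiorProd Z α) = (0 : FormsModExact E M F p)) ↔ α = 0 :=
  ⟨fun h => eq_zero_of_forall_extD_interiorProd fun Z =>
    extD_eq_zero_of_formClass_eq_zero (h Z), by rintro rfl; simp⟩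

/-- A zero contraction is in particular closed, so rigidity applies. This strips the outer
contractions, where equality is strict rather than modulo exact forms. -/
theorem forall_interiorProd_eq_zero_iff [T2Space M] {k : ℕ} {α : DiffForm E M F (k + 1)} :
    (∀ Z : VecField E M, interiorProd Z α = 0) ↔ α = 0 :=
  ⟨fun h => eq_zero_of_forall_extD_interiorProd fun Z => by rw [h, map_zero],
    by rintro rfl; simp⟩

/-- Polarization of `i_X i_X = 0` at `X + Y`. -/
theorem interiorProd_interiorProd (X Y : VecField E M) {k : ℕ} (α : DiffForm E M F (k + 2)) :
    interiorProd X (interiorProd Y α) = -interiorProd Y (interiorProd X α) := by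
  have h := interiorProd_self (X + Y) α
  rw [interiorProd_add_left, interiorProd_add_left, map_add, map_add, interiorProd_self,
    interiorProd_self, zero_add, add_zero] at h
  exact eq_neg_of_add_eq_zero_left h

theorem formCochain_apply {p : ℕ} (ω' : DiffForm E M F (p + 2)) (X Y : VecField E M) :
    formCochain ω' X Y = formClass (interiorProd Y (interiorProd X ω')) := rfl

/-! ### Coboundary and Lie derivative of the cochain of a form. -/

open LieModule.Cohomology

/-- The coboundary of the cochain of a form is the cochain of its exterior derivative. -/
theorem d₂₃_formCochain {p : ℕ} (ω' : DiffForm E M F (p + 2)) (X Y Z : VecField E M) :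
    d₂₃ ℝ (VecField E M) (FormsModExact E M F p) (formCochain ω') X Y Z =
      formClass (interiorProd Z (interiorProd Y (interiorProd X (extD ω')))) := by
  have h1 : ∀ (U V : VecField E M) {m : ℕ} (β : DiffForm E M F (m + 1)), interiorProd ⁅U, V⁆ β =
      lieDer U m (interiorProd V β) - interiorProd V (lieDer U (m + 1) β) := fun U V _ β => by
    rw [lieDer_interiorProd]; abel
  have h2 : lieDer X (p + 2) ω' = interiorProd X (extD ω') + extD (interiorProd X ω') := rfl
  have h3 : lieDer Y (p + 1) (interiorProd X ω') = interiorProd Y (extD (interiorProd X ω')) +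
    extD (interiorProd Y (interiorProd X ω')) := rfl
  rw [d₂₃_apply]
  simp only [formCochain_apply, lie_formClass]
  -- The swaps bring the bracket contractions outermost, so that `h1` expands each into a
  -- commutator. The terms `L_X i_Z i_Y ω'` and `L_Y i_Z i_X ω'` then cancel against the module
  -- action. Only the action of `Z` needs the quotient, where `L_Z` becomes `i_Z d`; the resulting
  -- `i_Z d i_Y i_X ω'` cancels with `h3`, and `i_Z i_Y d i_X ω'` from `h2` with its copy in `h3`.
  rw [interiorProd_interiorProd Y ⁅X, Z⁆, interiorProd_interiorProd X ⁅Y, Z⁆, h1 X Y, h1 X Z,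
    h1 Y Z, h2, h3, formClass_lieDer Z]
  simp only [map_add, map_sub, map_neg]
  abel

/-- The Lie derivative of the cochain of a form is the cochain of its Lie derivative. -/
theorem lie_formCochain {p : ℕ} (ω' : DiffForm E M F (p + 2)) (X Y Z : VecField E M) :
    ⁅X, formCochain ω' Y Z⁆ - formCochain ω' ⁅X, Y⁆ Z - formCochain ω' Y ⁅X, Z⁆ =
      formCochain (lieDer X (p + 2) ω') Y Z := by
  simp only [formCochain_apply, lie_formClass]
  -- Moving `L_X` inward past `i_Z` and then `i_Y` produces exactly the two bracket terms being
  -- subtracted.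
  rw [lieDer_interiorProd, lieDer_interiorProd]
  simp only [map_add]
  abel

/-! ### Comparison of the cochain conditions with those on the form. -/

/-- Two contractions are removed in turn: rigidity modulo exact forms for `Z`, on the form `i_Y i_X
dω'` of degree `p + 1`, then the strict version for `Y`, on `i_X dω'`. The same statement serves the
cocycle criterion and the second symplectic condition. -/
theorem d₂₃_formCochain_apply_eq_zero_iff [T2Space M] {p : ℕ} (ω' : DiffForm E M F (p + 2))
    (X : VecField E M) :
    d₂₃ ℝ (VecField E M) (FormsModExact E M F p) (formCochain ω') X = 0 ↔
      interiorProd X (extD ω') = 0 := by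
  simp only [LinearMap.ext_iff, d₂₃_formCochain, LinearMap.zero_apply,
    forall_formClass_interiorProd_eq_zero_iff, forall_interiorProd_eq_zero_iff]

theorem formCochain_mem_twoCocycle_iff [T2Space M] {p : ℕ} (ω' : DiffForm E M F (p + 2)) :
    formCochain ω' ∈ twoCocycle ℝ (VecField E M) (FormsModExact E M F p) ↔ extD ω' = 0 := by
  rw [mem_twoCocycle_iff, ← forall_interiorProd_eq_zero_iff, LinearMap.ext_iff]
  exact forall_congr' (d₂₃_formCochain_apply_eq_zero_iff ω')

theorem symplecticElements_formCochain [T2Space M] {p : ℕ} (ω' : DiffForm E M F (p + 2)) :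
    symplecticElements (formCochain ω') = symplecticFields ω' := by
  ext X
  refine and_congr ?_ (d₂₃_formCochain_apply_eq_zero_iff ω' X)
  -- `L_X ω' = 0` is unfolded into the vanishing of all `i_Y L_X ω'`, and then into the exactness of
  -- all `i_Z i_Y L_X ω'`, which is the vanishing of the Lie derivative of the cochain.
  rw [← forall_interiorProd_eq_zero_iff]
  refine forall_congr' fun Y => ?_
  rw [← forall_formClass_interiorProd_eq_zero_iff]
  refine forall_congr' fun Z => ?_
  rw [← formCochain_apply, ← lie_formCochain]

theorem hamiltonianElements_formCochain [T2Space M] {p : ℕ} (ω' : DiffForm E M F (p + 2)) :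
    hamiltonianElements (formCochain ω') = hamiltonianFields ω' := by
  ext X
  refine and_congr (by rw [symplecticElements_formCochain]) ?_
  -- Every potential `v` in the quotient has a representative `θ`, and the same `θ` serves as
  -- primitive of `i_X ω'`.
  refine (Submodule.mkQ_surjective (exactForms E M F p).toSubmodule).exists.trans ?_
  refine exists_congr fun θ => ?_
  rw [← sub_eq_zero, ← forall_formClass_interiorProd_eq_zero_iff]
  refine forall_congr' fun Z => ?_
  -- The class of `i_Z dθ` is that of `L_Z θ`, which is the action of `Z` on `[θ]`.
  rw [map_sub, map_sub, sub_eq_zero, ← formClass_lieDer]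
  rfl

end ManifoldForms

theorem proposition1p9
    {E M F : Type*} [NormedAddCommGroup E] [NormedSpace ℝ E] [FiniteDimensional ℝ E]
    [TopologicalSpace M] [T2Space M] [ParacompactSpace M]
    [ChartedSpace E M] [IsManifold 𝓘(ℝ, E) ∞ M]
    [AddCommGroup F] [Module ℝ F] [TopologicalSpace F] [IsTopologicalAddGroup F]
    [ContinuousSMul ℝ F] [LocallyConvexSpace ℝ F] [T2Space F]
    (p : ℕ) (ω' : DiffForm E M F (p + 2)) :
    (formCochain ω' ∈ LieModule.Cohomology.twoCocycle ℝ (VecField E M) (FormsModExact E M F p) ↔ extD ω' = 0) ∧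
    symplecticElements (formCochain ω') = symplecticFields ω' ∧
    hamiltonianElements (formCochain ω') = hamiltonianFields ω' := by
  exact ⟨formCochain_mem_twoCocycle_iff ω', symplecticElements_formCochain ω',
    hamiltonianElements_formCochain ω'⟩
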